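/- Let $n\ge 0$, $m\ge 1$, $K\ge 1$, $\alpha,\lambda\in(0,1)$. Let $(X_j,Y_j)_{j\in[n+m]}$ be random labelled examples with covariates $X_j$ in a measurable space $\mathcal X$ and labels $Y_j\in[K]$; the first $n$ form the calibration sample, the last $m$ the batch. Let $S_k:\mathcal X\to\mathbb R$, $k\in[K]$, be fixed measurable score functions such that the scores $S_{Y_j}(X_j)$, $j\in[n+m]$, have almost surely no ties. For $k\in[K]$, $i\in[m]$ let $$p_i^{(k)}=\frac{1}{|\mathcal D^{(k)}|+1}\Big(1+\sum_{j\in\mathcal D^{(k)}}\mathbf 1\{S_{Y_j}(X_j)\ge S_k(X_{n+i})\}\Big),$$ where $\mathcal D^{(k)}=[n]$ (full-calibrated $p$-values) or $\mathcal D^{(k)}=\{j\in[n]:Y_j=k\}$, of size $n_k$ (class-calibrated $p$-values). For $y=(y_i)_{i\in[m]}\in[K]^m$ let $p_{(1)}(y)\le\dots\le p_{(m)}(y)$ be the ordered values of $p_1^{(y_1)},\dots,p_m^{(y_m)}$. Given an estimator $\hat m_0(y)$, the adaptive Simes batch prediction set is $$\mathcal C^m_\alpha=\Big\{y\in[K]^m:\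 \min_{\ell\in[m]}\frac{\hat m_0(y)\,p_{(\ell)}(y)}{\ell}>\alpha\Big\}.$$ (i) IID model. Suppose that the pairs $(X_j,Y_j)$, $j\in[n+m]$, are iid, and use full-calibrated $p$-values. Then $\mathbb P\big((Y_{n+i})_{i\in[m]}\in\mathcal C^m_\alpha\big)\ge 1-\alpha$ with the Storey estimator $$\hat m_0(y)=(1-\lambda)^{-1}\Big(1+\sum_{i=1}^m\mathbf 1\{p_i^{(y_i)}\ge\lambda\}\Big)\qquad(1)$$ if $(n+1)\lambda$ is an integer, and, for every $\lambda\in(0,1)$, with $\hat m_0(y)=(1-\lambda)^{-1}\big(1+\sum_{i=1}^m\mathbf 1\{p_i^{(y_i)}\ge\lfloor(n+1)\lambda\rfloor/(n+1)\}\big)$. (ii) Conditional model. Suppose that, conditionally on $(Y_j)_{j\in[n+m]}$, the covariates $X_j$ are independent and $X_j$ has a law $Q_{Y_j}$ that depends only on the label $Y_j$ (the law of the label vector is arbitrary), and use class-calibrated $p$-values. Then, for every label vector $(y_j)_{j\in[n+m]}$ of positive probability, conditionally on $(Y_j)_{j\in[n+m]}=(y_j)_{j\in[n+m]}$, the event $(Y_{n+i})_{i\in[m]}\in\mathcal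 C^m_\alpha$ has probability at least $1-\alpha$: with the estimator (1) if $(n_k+1)\lambda$ is an integer for all $k\in[K]$; and, if $m\ge2$, for every $\lambda\in(0,1)$ with $$\hat m_0(y)=\kappa(y)\Big(1+\sum_{i=1}^m\mathbf 1\{p_i^{(y_i)}\ge\lambda_{y_i}\}\Big),\quad \lambda_k=\frac{\lfloor\lambda(n_k+1)\rfloor}{n_k+1},\quad \kappa(y)=\Big(1-\min_{k\in[K]}\lambda_k\Big)^{\frac1{m-1}}\prod_{k\in[K]}\Big(\frac1{1-\lambda_k}\Big)^{\frac{m_k(y)}{m-1}},$$ where $m_k(y)=\#\{i\in[m]:y_i=k\}$. -/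

import Mathlib

open MeasureTheory ProbabilityTheory

noncomputable section

namespace BatchConformal

/-! Examples are indexed by `Fin n ⊕ Fin m`: `Sum.inl j` is the `j`-th calibration example and
`Sum.inr i` is the `i`-th example of the batch.  Classes are the elements of `Fin K`. -/

variable {𝒳 Ω : Type*} {K n m : ℕ}

/-- The conformal `p`-value of class `k` for the `i`-th batch example, with calibration set `D k`
for class `k`, scores `S`, covariates `x` and calibration labels `c`. -/
def pValue (D : Fin K → Finset (Fin n)) (S : Fin K → 𝒳 → ℝ) (x : Fin n ⊕ Fin m → 𝒳)
    (c : Fin n → Fin K) (k : Fin K) (i : Fin m) : ℝ :=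
  (1 + ∑ j ∈ D k, if S k (x (Sum.inr i)) ≤ S (c j) (x (Sum.inl j)) then (1 : ℝ) else 0)
    / (((D k).card : ℝ) + 1)

/-- The examples of the calibration sample that carry label `k`. -/
def classCal (c : Fin n → Fin K) (k : Fin K) : Finset (Fin n) :=
  Finset.univ.filter fun j => c j = k

/-- The number `n_k` of calibration examples of class `k`. -/
def classCount (c : Fin n → Fin K) (k : Fin K) : ℕ := (classCal c k).card

/-- Full-calibrated `p`-values: every class is calibrated on the whole calibration sample. -/
def fullPValue (S : Fin K → 𝒳 → ℝ) (x : Fin n ⊕ Fin m → 𝒳) (c : Fin n → Fin K) :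
    Fin K → Fin m → ℝ :=
  pValue (fun _ => Finset.univ) S x c

/-- Class-calibrated `p`-values: class `k` is calibrated on the calibration examples of label `k`. -/
def classPValue (S : Fin K → 𝒳 → ℝ) (x : Fin n ⊕ Fin m → 𝒳) (c : Fin n → Fin K) :
    Fin K → Fin m → ℝ :=
  pValue (classCal c) S x c

/-- The order statistics of `p` in nondecreasing order: `orderStat p ℓ` is the `(ℓ + 1)`-st
smallest coordinate of `p` (`ℓ = 0, …, m - 1`). -/
def orderStat (p : Fin m → ℝ) (ℓ : Fin m) : ℝ := p (Tuple.sort p ℓ)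

/-- The adaptive Simes `p`-value `min_{1 ≤ ℓ ≤ m} m₀ p_(ℓ) / ℓ` (a minimum over a finite set,
which is non-empty when `m ≥ 1`). -/
def simesAdapt (m₀ : ℝ) (p : Fin m → ℝ) : ℝ :=
  ⨅ ℓ : Fin m, m₀ * orderStat p ℓ / ((ℓ : ℝ) + 1)

/-- The adaptive Simes batch prediction set at level `α`, from the `p`-values `pv k i` and the
estimator `m₀` (evaluated at the candidate batch `y`). -/
def predSet (pv : Fin K → Fin m → ℝ) (m₀ : (Fin m → Fin K) → ℝ) (α : ℝ) :
    Set (Fin m → Fin K) :=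
  {y | α < simesAdapt (m₀ y) (fun i => pv (y i) i)}

/-- The Storey estimator
`(1 - lam)⁻¹ (1 + #{i : p_i^{(y_i)} ≥ lam})`. -/
def storey (lam : ℝ) (pv : Fin K → Fin m → ℝ) (y : Fin m → Fin K) : ℝ :=
  (1 - lam)⁻¹ * (1 + ∑ i : Fin m, if lam ≤ pv (y i) i then (1 : ℝ) else 0)

/-- The rounded parameter `⌊lam (N + 1)⌋ / (N + 1)`. -/
def roundLevel (lam : ℝ) (N : ℕ) : ℝ := (⌊lam * ((N : ℝ) + 1)⌋ : ℝ) / ((N : ℝ) + 1)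

/-- The Storey-type estimator for full-calibrated `p`-values and arbitrary `lam`, where `N` is the
size of the calibration sample. -/
def storeyFull (lam : ℝ) (N : ℕ) (pv : Fin K → Fin m → ℝ) (y : Fin m → Fin K) : ℝ :=
  (1 - lam)⁻¹ *
    (1 + ∑ i : Fin m, if roundLevel lam N ≤ pv (y i) i then (1 : ℝ) else 0)

/-- The number `m_k(y)` of coordinates of the batch `y` equal to `k`. -/
def batchCount (y : Fin m → Fin K) (k : Fin K) : ℕ :=
  (Finset.univ.filter fun i => y i = k).card

/-- The correction factor `κ(y)`, where `N k` is the number of calibration examples of class `k`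
(the infimum is a minimum over the classes; used for `m ≥ 2` only). -/
def kappa (lam : ℝ) (N : Fin K → ℕ) (y : Fin m → Fin K) : ℝ :=
  (1 - ⨅ k : Fin K, roundLevel lam (N k)) ^ (1 / ((m : ℝ) - 1)) *
    ∏ k : Fin K,
      (1 / (1 - roundLevel lam (N k))) ^ ((batchCount y k : ℝ) / ((m : ℝ) - 1))

/-- The Storey-type estimator for class-calibrated `p`-values and arbitrary `lam`. -/
def storeyClass (lam : ℝ) (N : Fin K → ℕ) (pv : Fin K → Fin m → ℝ) (y : Fin m → Fin K) : ℝ :=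
  kappa lam N y *
    (1 + ∑ i : Fin m, if roundLevel lam (N (y i)) ≤ pv (y i) i then (1 : ℝ) else 0)

/-- The iid model: the labelled examples `(X_j, Y_j)` are independent and identically
distributed. -/
structure IIDModel [MeasurableSpace 𝒳] [MeasurableSpace Ω] (P : Measure Ω)
    (X : Fin n ⊕ Fin m → Ω → 𝒳) (Y : Fin n ⊕ Fin m → Ω → Fin K) : Prop where
  indep : iIndepFun (fun j ω => (X j ω, Y j ω)) P
  ident : ∀ i j, IdentDistrib (fun ω => (X i ω, Y i ω)) (fun ω => (X j ω, Y j ω)) P P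

/-- The event that the vector of all labels is `y`. -/
def labelEvent (Y : Fin n ⊕ Fin m → Ω → Fin K) (y : Fin n ⊕ Fin m → Fin K) : Set Ω :=
  {ω | ∀ j, Y j ω = y j}

/-- The conditional model: given the vector of all labels, the covariates are independent, and a
covariate with label `k` has law `Q k`.  The law of the vector of labels is arbitrary (in
particular it may be deterministic). -/
structure ConditionalModel [MeasurableSpace 𝒳] [MeasurableSpace Ω] (P : Measure Ω)
    (X : Fin n ⊕ Fin m → Ω → 𝒳) (Y : Fin n ⊕ Fin m → Ω → Fin K)
    (Q : Fin K → Measure 𝒳) : Prop where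
  indep : ∀ y, P (labelEvent Y y) ≠ 0 → iIndepFun X (cond P (labelEvent Y y))
  law : ∀ y, P (labelEvent Y y) ≠ 0 →
    ∀ j, (cond P (labelEvent Y y)).map (X j) = Q (y j)

/-- The event that the batch prediction set, computed from the covariates and the calibration
labels by the rule `C`, contains the true labels of the batch. -/
def coverEvent (C : (Fin n ⊕ Fin m → 𝒳) → (Fin n → Fin K) → Set (Fin m → Fin K))
    (X : Fin n ⊕ Fin m → Ω → 𝒳) (Y : Fin n ⊕ Fin m → Ω → Fin K) : Set Ω :=
  {ω | (fun i => Y (Sum.inr i) ω) ∈ C (fun j => X j ω) (fun j => Y (Sum.inl j) ω)}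

end BatchConformal

end

/-! Coverage involves only the scores of the true labels, which are independent with laws depending
on a class: the label in the conditional model, one single class in the iid model. If the batch is
missed, the step-up count `R` of the true `p`-values `p_i`, with estimator `C * (1 + V)`, is
positive; here `V` counts the `p`-values above their thresholds. When `R > 0`, at least `R` indices
satisfy `C * (1 + V) * p_i ≤ α * R`, so the sum over these `i` of `1 / R` is at least 1.

Fix `i` and average over swaps of `i` with the members of its pool, which preserve the law. A
leave-one-out count `T_i ≤ V` (`residual`) is invariant under these swaps, and moving a larger score
to position `i` lowers every `p`-value and thus does not lower `R`. The step-up bound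
`sum_inv_of_exceed_le` then gives `i` a contribution of at most `(α / C) * E[1 / (1 + T_i)]`. Hence
the level is `α` as soon as the sum over `i` of `E[1 / (1 + T_i)]` is at most `C`
(`measure_stepUp_pos_le`).

This sum is bounded in two ways. Let `λ_i` be the threshold of the class of `i`. If all `λ_i ≤ λ`,
super-uniformity of the rank of `i` in its pool gives `(1 - λ_i) * E[1 / (1 + T_i)] ≤ E[1{p_i > λ_i}
/ (1 + T_i)]`. At most `1 + T_i` indices lie strictly above their thresholds, so the right-hand
sides sum to at most 1, and `C = 1 / (1 - λ)` works. For `κ`, write `1 / (1 + T) = ∫ t ^ T` over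
`(0, 1]`. Given the calibration scores and the score of `i`, the other test scores are independent,
so `E[t ^ T_i]` is the mean of a product of `1 - q_j * (1 - t)`. The AM-GM inequality, Hölder's
inequality and `E[1 / q_j] ≤ 1 / (1 - λ_j)` finish (`lintegral_inv_residual_le`). -/

noncomputable section

set_option linter.unusedSectionVars false

namespace BatchConformal

open scoped ENNReal

/-! ### Ranks in a finite family of scores. -/

section Ranks

variable {J : Type*}

/-- The number of indices of `T` whose score is at least `s`. -/
def exceed (T : Finset J) (z : J → ℝ) (s : ℝ) : ℕ := (T.filter fun v => s ≤ z v).card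

lemma exceed_antitone (T : Finset J) (z : J → ℝ) {s t : ℝ} (h : s ≤ t) :
    exceed T z t ≤ exceed T z s :=
  Finset.card_le_card fun v hv => by
    simp only [Finset.mem_filter] at hv ⊢
    exact ⟨hv.1, h.trans hv.2⟩

lemma exceed_mono {T T' : Finset J} (hT : T ⊆ T') (z : J → ℝ) (s : ℝ) :
    exceed T z s ≤ exceed T' z s :=
  Finset.card_le_card (Finset.filter_subset_filter _ hT)

lemma exceed_insert [DecidableEq J] {T : Finset J} {j : J} (hj : j ∉ T) (z : J → ℝ) (s : ℝ) :
    exceed (insert j T) z s = exceed T z s + if s ≤ z j then 1 else 0 := by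
  unfold exceed
  rw [Finset.filter_insert]
  split_ifs with h
  · rw [Finset.card_insert_of_notMem (by simp [hj])]
  · simp

lemma exceed_congr {T : Finset J} {z z' : J → ℝ} (h : ∀ v ∈ T, z v = z' v) (s : ℝ) :
    exceed T z s = exceed T z' s := by
  unfold exceed
  congr 1
  exact Finset.filter_congr fun v hv => by rw [h v hv]

lemma exceed_comp_equiv (T : Finset J) (z : J → ℝ) (s : ℝ) (σ : Equiv.Perm J)
    (hσ : ∀ v, σ v ∈ T ↔ v ∈ T) : exceed T (z ∘ σ) s = exceed T z s := by
  unfold exceed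
  refine Finset.card_bij (fun v _ => σ v) ?_ (fun _ _ _ _ h => σ.injective h) ?_
  · intro v hv
    simp only [Finset.mem_filter, Function.comp] at hv ⊢
    exact ⟨(hσ v).2 hv.1, hv.2⟩
  · intro w hw
    simp only [Finset.mem_filter] at hw
    refine ⟨σ.symm w, ?_, by simp⟩
    simp only [Finset.mem_filter, Function.comp, Equiv.apply_symm_apply]
    exact ⟨(hσ _).1 (by simpa using hw.1), hw.2⟩

/-- The step-up bound for the ranks of a finite family: if `R` does not increase when the score
decreases, then the average of `1 / R` over the `w` with rank at most `c * R w` is at most `c`. -/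
lemma sum_inv_of_exceed_le (T : Finset J) (z : J → ℝ) (R : J → ℕ) {c : ℝ} (hc : 0 ≤ c)
    (hR : ∀ w ∈ T, ∀ w' ∈ T, z w' ≤ z w → R w' ≤ R w) :
    ∑ w ∈ T, (if 0 < R w ∧ (exceed T z (z w) : ℝ) ≤ c * R w then (R w : ℝ)⁻¹ else 0) ≤ c := by
  rw [← Finset.sum_filter]
  set F := T.filter fun w => 0 < R w ∧ (exceed T z (z w) : ℝ) ≤ c * R w with hF
  rcases F.eq_empty_or_nonempty with h | h
  · rw [h]; simpa using hc
  -- Take the qualifying index with the smallest score: every other one scores at least as much, so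
  -- the rank of `w₀` bounds their number and `R w₀` is the smallest of their `R`.
  · obtain ⟨w₀, hw₀, hmin⟩ := Finset.exists_min_image F z h
    have hw₀' := hw₀
    simp only [hF, Finset.mem_filter] at hw₀'
    obtain ⟨hT, hpos, hle⟩ := hw₀'
    have hpos' : (0 : ℝ) < R w₀ := by exact_mod_cast hpos
    have hsub : F ⊆ T.filter fun v => z w₀ ≤ z v := fun w hw => by
      have h1 := hmin w hw
      simp only [hF, Finset.mem_filter] at hw ⊢
      exact ⟨hw.1, h1⟩
    have hcard : (F.card : ℝ) ≤ c * R w₀ :=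
      le_trans (by exact_mod_cast Finset.card_le_card hsub) hle
    calc ∑ w ∈ F, (R w : ℝ)⁻¹ ≤ ∑ _w ∈ F, (R w₀ : ℝ)⁻¹ := by
          refine Finset.sum_le_sum fun w hw => ?_
          have h1 := hmin w hw
          simp only [hF, Finset.mem_filter] at hw
          have := hR w hw.1 w₀ hT h1
          exact inv_anti₀ hpos' (by exact_mod_cast this)
      _ = F.card * (R w₀ : ℝ)⁻¹ := by simp
      _ ≤ c * R w₀ * (R w₀ : ℝ)⁻¹ := by gcongr
      _ = c := by field_simp

/-- The case `R = 1` of the step-up bound. A rank counts all tied scores, so ties can only enlarge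
it; this is the super-uniformity of conformal `p`-values. -/
lemma card_exceed_le (T : Finset J) (z : J → ℝ) (r : ℕ) :
    (T.filter fun w => exceed T z (z w) ≤ r).card ≤ r := by
  have := sum_inv_of_exceed_le T z (fun _ => 1) (c := r) (by positivity) (fun _ _ _ _ _ => le_rfl)
  simp only [zero_lt_one, Nat.cast_one, mul_one, true_and, inv_one, Nat.cast_le,
    Finset.sum_boole] at this
  exact_mod_cast this

lemma card_le_card_lt_exceed_add (T : Finset J) (z : J → ℝ) (r : ℕ) :
    T.card ≤ (T.filter fun w => r < exceed T z (z w)).card + r := by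
  have h1 := card_exceed_le T z r
  have h2 := Finset.card_filter_add_card_filter_not (s := T) fun w => exceed T z (z w) ≤ r
  simp only [not_le] at h2
  omega

end Ranks

/-! ### The step-up count. -/

section StepUp

variable {B : Type*} [Fintype B]

/-- The largest `k` such that at least `k` coordinates satisfy `m₀ * p i ≤ α * k`. -/
def stepUp (m₀ α : ℝ) (p : B → ℝ) : ℕ :=
  Nat.findGreatest (fun k => k ≤ (Finset.univ.filter fun i => m₀ * p i ≤ α * k).card)
    (Fintype.card B)

lemma stepUp_spec (m₀ α : ℝ) (p : B → ℝ) :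
    stepUp m₀ α p ≤ (Finset.univ.filter fun i => m₀ * p i ≤ α * stepUp m₀ α p).card :=
  Nat.findGreatest_spec
    (P := fun k : ℕ => k ≤ (Finset.univ.filter fun i => m₀ * p i ≤ α * k).card)
    (Nat.zero_le _) (Nat.zero_le _)

lemma le_stepUp {m₀ α : ℝ} {p : B → ℝ} {k : ℕ}
    (hk : k ≤ (Finset.univ.filter fun i => m₀ * p i ≤ α * k).card) : k ≤ stepUp m₀ α p :=
  Nat.le_findGreatest (hk.trans (Finset.card_le_univ _)) hk

lemma stepUp_anti {m₀ m₁ α : ℝ} {p q : B → ℝ} (hm₀ : 0 ≤ m₀) (hm : m₀ ≤ m₁) (hp : ∀ i, 0 ≤ p i)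
    (hpq : ∀ i, p i ≤ q i) : stepUp m₁ α q ≤ stepUp m₀ α p := by
  refine le_stepUp ((stepUp_spec m₁ α q).trans (Finset.card_le_card fun i hi => ?_))
  simp only [Finset.mem_filter, Finset.mem_univ, true_and] at hi ⊢
  exact (mul_le_mul hm (hpq i) (hp i) (hm₀.trans hm)).trans hi

/-- By self-consistency at least `R` coordinates meet the bound, each contributing `1 / R`. This
turns the probability of a miss into a sum of expectations, one per test index. -/
lemma one_le_sum_stepUp {m₀ α : ℝ} {p : B → ℝ} (h : 0 < stepUp m₀ α p) :
    1 ≤ ∑ i, if 0 < stepUp m₀ α p ∧ m₀ * p i ≤ α * stepUp m₀ α p then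
      (stepUp m₀ α p : ℝ)⁻¹ else 0 := by
  have h1 := stepUp_spec m₀ α p
  have hpos : (0 : ℝ) < stepUp m₀ α p := by exact_mod_cast h
  rw [← Finset.sum_filter, Finset.sum_const, nsmul_eq_mul]
  simp only [h, true_and]
  rw [← div_eq_mul_inv, one_le_div hpos]
  exact_mod_cast h1

end StepUp

/-! ### Pools, and the effect of swapping a test score with a pool member. -/

section Pools

variable {A B κ : Type*} [Fintype A] [Fintype B] [DecidableEq A] [DecidableEq B] [DecidableEq κ]

/-- The calibration indices of class `k`. -/
def cal (c : A ⊕ B → κ) (k : κ) : Finset (A ⊕ B) :=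
  Finset.univ.filter fun v => v.isLeft = true ∧ c v = k

/-- The test index `i` together with the calibration indices of its class. -/
def pool (c : A ⊕ B → κ) (i : B) : Finset (A ⊕ B) :=
  insert (Sum.inr i) (cal c (c (Sum.inr i)))

/-- The class-calibrated conformal `p`-value of the test index `i` for its own class. -/
def trueP (c : A ⊕ B → κ) (z : A ⊕ B → ℝ) (i : B) : ℝ :=
  (1 + exceed (cal c (c (Sum.inr i))) z (z (Sum.inr i))) / ((cal c (c (Sum.inr i))).card + 1)

/-- The number of `p`-values that are at least `r k / (N k + 1)`, `k` being their class and `N k`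
its calibration size. -/
def aboveCount (c : A ⊕ B → κ) (r : κ → ℕ) (z : A ⊕ B → ℝ) : ℕ :=
  (Finset.univ.filter fun j : B => r (c (Sum.inr j)) ≤
    1 + exceed (cal c (c (Sum.inr j))) z (z (Sum.inr j))).card

/-- The event that the lower bound for the `j`-th `p`-value, when the pool of `i` is known only as
a set, exceeds its threshold. -/
def residualAbove (c : A ⊕ B → κ) (r : κ → ℕ) (i : B) (z : A ⊕ B → ℝ) (j : B) (s : ℝ) : Prop :=
  r (c (Sum.inr j)) ≤ if c (Sum.inr j) = c (Sum.inr i) then exceed (pool c i) z s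
    else 1 + exceed (cal c (c (Sum.inr j))) z s

instance (c : A ⊕ B → κ) (r : κ → ℕ) (i : B) (z : A ⊕ B → ℝ) (j : B) (s : ℝ) :
    Decidable (residualAbove c r i z j s) :=
  inferInstanceAs (Decidable (_ ≤ _))

/-- A lower bound for the number of `p`-values other than the `i`-th above their thresholds, that
is invariant under permutations of the pool of `i`. -/
def residual (c : A ⊕ B → κ) (r : κ → ℕ) (i : B) (z : A ⊕ B → ℝ) : ℕ :=
  ((Finset.univ.erase i).filter fun j => residualAbove c r i z j (z (Sum.inr j))).card

variable {c : A ⊕ B → κ}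

lemma inr_notMem_cal (k : κ) (i : B) : Sum.inr i ∉ cal c k := by simp [cal]

lemma cal_subset_pool (i : B) : cal c (c (Sum.inr i)) ⊆ pool c i := Finset.subset_insert _ _

lemma card_pool (i : B) : (pool c i).card = (cal c (c (Sum.inr i))).card + 1 :=
  Finset.card_insert_of_notMem (inr_notMem_cal _ _)

lemma class_of_mem_pool {i : B} {w : A ⊕ B} (hw : w ∈ pool c i) : c w = c (Sum.inr i) := by
  simp only [pool, cal, Finset.mem_insert, Finset.mem_filter, Finset.mem_univ, true_and] at hw
  rcases hw with rfl | h
  · rfl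
  · exact h.2

lemma inr_ne_of_mem_pool {i j : B} (hj : j ≠ i) {w : A ⊕ B} (hw : w ∈ pool c i) :
    Sum.inr j ≠ w := by
  rintro rfl
  simp only [pool, Finset.mem_insert, Sum.inr.injEq] at hw
  exact hw.elim hj (inr_notMem_cal _ _)

lemma trueP_nonneg (z : A ⊕ B → ℝ) (i : B) : 0 ≤ trueP c z i := by unfold trueP; positivity

lemma exceed_pool (z : A ⊕ B → ℝ) (i : B) (s : ℝ) :
    exceed (pool c i) z s =
      exceed (cal c (c (Sum.inr i))) z s + if s ≤ z (Sum.inr i) then 1 else 0 :=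
  exceed_insert (inr_notMem_cal _ _) z s

lemma exceed_pool_self (z : A ⊕ B → ℝ) (i : B) :
    exceed (pool c i) z (z (Sum.inr i)) =
      exceed (cal c (c (Sum.inr i))) z (z (Sum.inr i)) + 1 := by
  simp [exceed_pool]

lemma exceed_pool_swap {i : B} {w : A ⊕ B} (hw : w ∈ pool c i) (z : A ⊕ B → ℝ) (s : ℝ) :
    exceed (pool c i) (z ∘ Equiv.swap (Sum.inr i) w) s = exceed (pool c i) z s := by
  refine exceed_comp_equiv _ _ _ _ fun v => ?_
  have hi : Sum.inr i ∈ pool c i := Finset.mem_insert_self _ _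
  rcases eq_or_ne v (Sum.inr i) with rfl | h1
  · simp [hw, hi]
  rcases eq_or_ne v w with rfl | h2
  · simp [hw, hi]
  · rw [Equiv.swap_apply_of_ne_of_ne h1 h2]

lemma exceed_cal_swap_of_ne {i : B} {w : A ⊕ B} (hw : w ∈ pool c i) (z : A ⊕ B → ℝ) {k : κ}
    (hk : k ≠ c (Sum.inr i)) (s : ℝ) :
    exceed (cal c k) (z ∘ Equiv.swap (Sum.inr i) w) s = exceed (cal c k) z s := by
  refine exceed_congr (fun v hv => ?_) s
  have hv' : c v = k := by simp only [cal, Finset.mem_filter] at hv; exact hv.2.2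
  rw [Function.comp, Equiv.swap_apply_of_ne_of_ne]
  · rintro rfl; exact hk hv'.symm
  · rintro rfl; exact hk (hv'.symm.trans (class_of_mem_pool hw))

lemma swap_inr_of_ne {i j : B} (hj : j ≠ i) {w : A ⊕ B} (hw : w ∈ pool c i) (z : A ⊕ B → ℝ) :
    (z ∘ Equiv.swap (Sum.inr i) w) (Sum.inr j) = z (Sum.inr j) := by
  rw [Function.comp, Equiv.swap_apply_of_ne_of_ne (by simpa using hj) (inr_ne_of_mem_pool hj hw)]

/-- After the swap, the calibration scores of the class of `i` are those of the pool with `z w`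
removed. -/
lemma exceed_cal_swap_add {i : B} {w : A ⊕ B} (hw : w ∈ pool c i) (z : A ⊕ B → ℝ) (s : ℝ) :
    exceed (cal c (c (Sum.inr i))) (z ∘ Equiv.swap (Sum.inr i) w) s + (if s ≤ z w then 1 else 0) =
      exceed (pool c i) z s := by
  rw [← exceed_pool_swap hw, exceed_pool]
  simp

lemma residualAbove_swap (r : κ → ℕ) {i : B} {w : A ⊕ B} (hw : w ∈ pool c i) (z : A ⊕ B → ℝ)
    (j : B) (s : ℝ) :
    residualAbove c r i (z ∘ Equiv.swap (Sum.inr i) w) j s ↔ residualAbove c r i z j s := by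
  unfold residualAbove
  split_ifs with h
  · rw [exceed_pool_swap hw]
  · rw [exceed_cal_swap_of_ne hw z h]

lemma residual_swap (r : κ → ℕ) {i : B} {w : A ⊕ B} (hw : w ∈ pool c i) (z : A ⊕ B → ℝ) :
    residual c r i (z ∘ Equiv.swap (Sum.inr i) w) = residual c r i z := by
  unfold residual
  congr 1
  refine Finset.filter_congr fun j hj => ?_
  rw [swap_inr_of_ne (Finset.ne_of_mem_erase hj) hw, residualAbove_swap r hw]

/-- A larger score at position `i` has a smaller rank itself, and its removal from the calibration
sample lowers the counts of the other test points of that class. Other classes do not notice the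
swap. This yields the monotonicity required by `sum_inv_of_exceed_le`. -/
lemma exceed_cal_swap_anti {i : B} {w w' : A ⊕ B} (hw : w ∈ pool c i) (hw' : w' ∈ pool c i)
    (z : A ⊕ B → ℝ) (h : z w' ≤ z w) (j : B) :
    exceed (cal c (c (Sum.inr j))) (z ∘ Equiv.swap (Sum.inr i) w)
        ((z ∘ Equiv.swap (Sum.inr i) w) (Sum.inr j)) ≤
      exceed (cal c (c (Sum.inr j))) (z ∘ Equiv.swap (Sum.inr i) w')
        ((z ∘ Equiv.swap (Sum.inr i) w') (Sum.inr j)) := by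
  rcases eq_or_ne j i with rfl | hj
  · have h1 := exceed_cal_swap_add hw z (z w)
    have h2 := exceed_cal_swap_add hw' z (z w')
    have h3 := exceed_antitone (pool c j) z h
    simp only [le_refl, if_true] at h1 h2
    simp only [Function.comp_apply, Equiv.swap_apply_left]
    simp only [Function.comp_def] at h1 h2
    simp only [Function.comp_def]
    omega
  · rw [swap_inr_of_ne hj hw, swap_inr_of_ne hj hw']
    rcases eq_or_ne (c (Sum.inr j)) (c (Sum.inr i)) with hc | hc
    · rw [hc]
      have h1 := exceed_cal_swap_add hw z (z (Sum.inr j))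
      have h2 := exceed_cal_swap_add hw' z (z (Sum.inr j))
      have : (if z (Sum.inr j) ≤ z w' then 1 else 0) ≤ if z (Sum.inr j) ≤ z w then 1 else 0 := by
        split_ifs with ha hb <;> first | omega | exact absurd (ha.trans h) hb
      omega
    · rw [exceed_cal_swap_of_ne hw z hc, exceed_cal_swap_of_ne hw' z hc]

lemma trueP_swap_anti {i : B} {w w' : A ⊕ B} (hw : w ∈ pool c i) (hw' : w' ∈ pool c i)
    (z : A ⊕ B → ℝ) (h : z w' ≤ z w) (j : B) :
    trueP c (z ∘ Equiv.swap (Sum.inr i) w) j ≤ trueP c (z ∘ Equiv.swap (Sum.inr i) w') j := by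
  unfold trueP
  gcongr
  exact exceed_cal_swap_anti hw hw' z h j

lemma aboveCount_swap_anti (r : κ → ℕ) {i : B} {w w' : A ⊕ B} (hw : w ∈ pool c i)
    (hw' : w' ∈ pool c i) (z : A ⊕ B → ℝ) (h : z w' ≤ z w) :
    aboveCount c r (z ∘ Equiv.swap (Sum.inr i) w) ≤
      aboveCount c r (z ∘ Equiv.swap (Sum.inr i) w') := by
  refine Finset.card_le_card fun j hj => ?_
  have := exceed_cal_swap_anti hw hw' z h j
  simp only [Finset.mem_filter, Finset.mem_univ, true_and] at hj ⊢
  omega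

/-- Replacing a calibration sample by a pool adds one score, hence at most one to a count; the `1 +`
in the numerator of the `p`-value pays for it. -/
lemma residual_le_aboveCount (r : κ → ℕ) (i : B) (z : A ⊕ B → ℝ) :
    residual c r i z ≤ aboveCount c r z := by
  refine Finset.card_le_card fun j hj => ?_
  simp only [Finset.mem_filter, Finset.mem_univ, true_and] at hj ⊢
  refine hj.2.trans ?_
  split_ifs with h
  · rw [exceed_pool, h]
    split_ifs <;> omega
  · exact le_rfl

/-- The number of test indices whose `p`-value is larger than its threshold is at most
`1 + residual`. -/
lemma card_above_le (r : κ → ℕ) (i : B) (z : A ⊕ B → ℝ) :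
    (Finset.univ.filter fun j : B => r (c (Sum.inr j)) ≤
      exceed (cal c (c (Sum.inr j))) z (z (Sum.inr j))).card ≤ 1 + residual c r i z := by
  rw [add_comm]
  refine le_trans (Finset.card_le_card (t := insert i
    ((Finset.univ.erase i).filter fun j => residualAbove c r i z j (z (Sum.inr j)))) ?_)
    (Finset.card_insert_le _ _)
  intro j hj
  simp only [Finset.mem_filter, Finset.mem_univ, true_and, Finset.mem_insert,
    Finset.mem_erase, and_true] at hj ⊢
  by_cases hji : j = i
  · exact Or.inl hji
  · refine Or.inr ⟨hji, hj.trans ?_⟩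
    split_ifs with h
    · rw [h]; exact exceed_mono (cal_subset_pool i) _ _
    · omega

end Pools

/-! ### Measurability of rank statistics. -/

section OrderInvariant

variable {J : Type*} [Fintype J]

/-- A function of finitely many real scores that depends only on their comparisons is
measurable. -/
lemma measurable_of_order {γ : Type*} [MeasurableSpace γ] {f : (J → ℝ) → γ}
    (hf : ∀ z z', (∀ v w, z v ≤ z w ↔ z' v ≤ z' w) → f z = f z') : Measurable f := by
  classical
  let φ : (J → ℝ) → J → J → Bool := fun z v w => decide (z v ≤ z w)
  have hφ : Measurable φ := by
    refine measurable_pi_lambda _ fun v => measurable_pi_lambda _ fun w => ?_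
    refine measurable_to_bool ?_
    have : (fun z : J → ℝ => decide (z v ≤ z w)) ⁻¹' {true} = {z | z v ≤ z w} := by
      ext z; simp
    rw [this]
    exact measurableSet_le (measurable_pi_apply v) (measurable_pi_apply w)
  -- The function factors through the finite table of comparisons, a countable discrete space on
  -- which every map is measurable.
  have hfac : f = (fun b => f (Function.invFun φ b)) ∘ φ := by
    funext z
    refine hf _ _ fun v w => ?_
    have h : φ (Function.invFun φ (φ z)) = φ z := Function.invFun_eq ⟨z, rfl⟩
    have h' := congrFun (congrFun h v) w
    simp only [φ] at h'
    simpa using h'.symm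
  rw [hfac]
  exact (measurable_of_countable _).comp hφ

lemma exceed_eq_of_order (T : Finset J) {z z' : J → ℝ} (h : ∀ v w, z v ≤ z w ↔ z' v ≤ z' w)
    (w : J) : exceed T z (z w) = exceed T z' (z' w) := by
  unfold exceed
  congr 1
  exact Finset.filter_congr fun v _ => h w v

end OrderInvariant

/-! ### Exchangeability within pools and the level of the step-up rule. -/

section Swaps

variable {A B κ : Type*} [Fintype A] [Fintype B] [DecidableEq A] [DecidableEq B] [DecidableEq κ]
  {c : A ⊕ B → κ}

lemma trueP_eq_of_order {z z' : A ⊕ B → ℝ} (h : ∀ v w, z v ≤ z w ↔ z' v ≤ z' w) (i : B) :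
    trueP c z i = trueP c z' i := by
  unfold trueP
  rw [exceed_eq_of_order _ h]

lemma aboveCount_eq_of_order (r : κ → ℕ) {z z' : A ⊕ B → ℝ}
    (h : ∀ v w, z v ≤ z w ↔ z' v ≤ z' w) : aboveCount c r z = aboveCount c r z' := by
  unfold aboveCount
  simp_rw [exceed_eq_of_order _ h]

lemma residualAbove_iff_of_order (r : κ → ℕ) (i : B) {z z' : A ⊕ B → ℝ}
    (h : ∀ v w, z v ≤ z w ↔ z' v ≤ z' w) (j : B) :
    residualAbove c r i z j (z (Sum.inr j)) ↔ residualAbove c r i z' j (z' (Sum.inr j)) := by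
  unfold residualAbove
  simp_rw [exceed_eq_of_order _ h]

lemma residual_eq_of_order (r : κ → ℕ) (i : B) {z z' : A ⊕ B → ℝ}
    (h : ∀ v w, z v ≤ z w ↔ z' v ≤ z' w) : residual c r i z = residual c r i z' := by
  unfold residual
  congr 1
  exact Finset.filter_congr fun j _ => residualAbove_iff_of_order r i h j

variable (ν : κ → Measure ℝ) [∀ k, IsProbabilityMeasure (ν k)]

lemma lintegral_comp_swap {v w : A ⊕ B} (h : c w = c v) (f : (A ⊕ B → ℝ) → ℝ≥0∞) :
    ∫⁻ z, f (z ∘ Equiv.swap v w) ∂Measure.pi (fun u => ν (c u)) =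
      ∫⁻ z, f z ∂Measure.pi (fun u => ν (c u)) := by
  have hc : ∀ u, c (Equiv.swap v w u) = c u := by
    intro u
    rcases eq_or_ne u v with rfl | h1
    · simp [h]
    rcases eq_or_ne u w with rfl | h2
    · simp [h]
    · rw [Equiv.swap_apply_of_ne_of_ne h1 h2]
  have hmp := measurePreserving_piCongrLeft (fun u => ν (c u)) (Equiv.swap v w)
  simp only [hc] at hmp
  have := hmp.lintegral_comp_emb (MeasurableEquiv.measurableEmbedding _) f
  rw [← this]
  refine lintegral_congr fun z => ?_
  congr 1
  funext u
  obtain ⟨u, rfl⟩ := (Equiv.swap v w).surjective u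
  rw [MeasurableEquiv.coe_piCongrLeft]
  rw [Equiv.piCongrLeft_apply_apply]
  simp

/-- Placing any member of the pool at position `i` leaves the product law unchanged, since all
members share one class. Expectations thus reduce to finite sums over the pool for fixed scores. -/
lemma card_pool_mul_lintegral (i : B) {f : (A ⊕ B → ℝ) → ℝ≥0∞} (hf : Measurable f) :
    ((pool c i).card : ℝ≥0∞) * ∫⁻ z, f z ∂Measure.pi (fun u => ν (c u)) =
      ∫⁻ z, ∑ w ∈ pool c i, f (z ∘ Equiv.swap (Sum.inr i) w) ∂Measure.pi (fun u => ν (c u)) := by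
  rw [lintegral_finsetSum]
  · rw [Finset.sum_congr rfl fun w hw =>
      lintegral_comp_swap ν (v := Sum.inr i) (class_of_mem_pool hw) f]
    simp
  · intro w _
    exact hf.comp (measurable_pi_lambda _ fun u => measurable_pi_apply _)

/-- The event that the rank of test index `i` among its calibration sample is at least `r`. -/
def lowEvent (c : A ⊕ B → κ) (r : ℕ) (i : B) : Set (A ⊕ B → ℝ) :=
  {z | r ≤ exceed (cal c (c (Sum.inr i))) z (z (Sum.inr i))}

lemma measurableSet_lowEvent (r : ℕ) (i : B) : MeasurableSet (lowEvent c r i) := by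
  have : Measurable fun z : A ⊕ B → ℝ => exceed (cal c (c (Sum.inr i))) z (z (Sum.inr i)) :=
    measurable_of_order fun z z' h => exceed_eq_of_order _ h _
  exact this (measurableSet_Ici (a := r))

lemma lowEvent_swap (r : ℕ) {i : B} {w : A ⊕ B} (hw : w ∈ pool c i) (z : A ⊕ B → ℝ) :
    z ∘ Equiv.swap (Sum.inr i) w ∈ lowEvent c r i ↔ r < exceed (pool c i) z (z w) := by
  have h := exceed_pool_self (c := c) (z ∘ Equiv.swap (Sum.inr i) w) i
  rw [exceed_pool_swap hw] at h
  simp only [lowEvent, Set.mem_ofPred_eq]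
  simp only [Function.comp_apply, Equiv.swap_apply_left] at h ⊢
  omega

/-- A function that is invariant under the permutations of the pool of `i` is, up to the factor
`1 - r / (N + 1)`, controlled by its integral over the event that `i` has rank larger than `r`. -/
lemma mul_lintegral_le_lowEvent {r : ℕ} (i : B) (hr : r ≤ (cal c (c (Sum.inr i))).card)
    {g : (A ⊕ B → ℝ) → ℝ≥0∞} (hg : Measurable g)
    (hinv : ∀ w ∈ pool c i, ∀ z, g (z ∘ Equiv.swap (Sum.inr i) w) = g z) :
    ENNReal.ofReal (1 - (r : ℝ) / ((cal c (c (Sum.inr i))).card + 1)) *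
        ∫⁻ z, g z ∂Measure.pi (fun u => ν (c u)) ≤
      ∫⁻ z, (lowEvent c r i).indicator g z ∂Measure.pi (fun u => ν (c u)) := by
  set N := (cal c (c (Sum.inr i))).card with hN
  have hcard : (pool c i).card = N + 1 := card_pool i
  have h1 := card_pool_mul_lintegral (c := c) ν i
    (hg.indicator (measurableSet_lowEvent (c := c) r i))
  have h2 : ((N + 1 - r : ℕ) : ℝ≥0∞) * ∫⁻ z, g z ∂Measure.pi (fun u => ν (c u)) ≤
      ((N + 1 : ℕ) : ℝ≥0∞) *
        ∫⁻ z, (lowEvent c r i).indicator g z ∂Measure.pi (fun u => ν (c u)) := by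
    rw [← hcard, h1, hcard, ← lintegral_const_mul _ hg]
    refine lintegral_mono fun z => ?_
    have hsum : ∑ w ∈ pool c i, (lowEvent c r i).indicator g (z ∘ Equiv.swap (Sum.inr i) w) =
        (((pool c i).filter fun w => r < exceed (pool c i) z (z w)).card : ℝ≥0∞) * g z := by
      rw [← nsmul_eq_mul, ← Finset.sum_const, Finset.sum_filter]
      refine Finset.sum_congr rfl fun w hw => ?_
      by_cases hlow : r < exceed (pool c i) z (z w)
      · rw [Set.indicator_of_mem ((lowEvent_swap r hw z).2 hlow), hinv w hw z, if_pos hlow]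
      · rw [Set.indicator_of_notMem (fun h => hlow ((lowEvent_swap r hw z).1 h)), if_neg hlow]
    rw [hsum]
    -- What remains is that at least `N + 1 - r` members of the pool have rank larger than `r`.
    gcongr
    have := card_le_card_lt_exceed_add (pool c i) z r
    omega
  have h3 : ENNReal.ofReal (1 - (r : ℝ) / ((N : ℝ) + 1)) =
      ((N + 1 : ℕ) : ℝ≥0∞)⁻¹ * ((N + 1 - r : ℕ) : ℝ≥0∞) := by
    have : (1 - (r : ℝ) / ((N : ℝ) + 1)) = ((N + 1 : ℕ) : ℝ)⁻¹ * ((N + 1 - r : ℕ) : ℝ) := by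
      push_cast [Nat.cast_sub (show r ≤ N + 1 by omega)]
      field_simp
    rw [this, ENNReal.ofReal_mul (by positivity), ENNReal.ofReal_inv_of_pos (by positivity),
      ENNReal.ofReal_natCast, ENNReal.ofReal_natCast]
  rw [h3, mul_assoc]
  calc _ ≤ ((N + 1 : ℕ) : ℝ≥0∞)⁻¹ * (((N + 1 : ℕ) : ℝ≥0∞) *
        ∫⁻ z, (lowEvent c r i).indicator g z ∂Measure.pi (fun u => ν (c u))) := by gcongr
    _ = _ := by
      rw [← mul_assoc, ENNReal.inv_mul_cancel (by simp) (ENNReal.natCast_ne_top _), one_mul]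

lemma measurable_residual (r : κ → ℕ) (i : B) : Measurable (residual c r i) :=
  measurable_of_order fun _ _ h => residual_eq_of_order r i h

lemma measurable_inv_residual (r : κ → ℕ) (i : B) :
    Measurable fun z => ENNReal.ofReal (1 + (residual c r i z : ℝ))⁻¹ :=
  measurable_of_order fun _ _ h => by rw [residual_eq_of_order r i h]

/-- The expected inverses of the leave-one-out counts, weighted by one minus the thresholds, sum up
to at most one. -/
lemma sum_mul_lintegral_inv_residual_le (r : κ → ℕ) (hr : ∀ k, r k ≤ (cal c k).card) :
    ∑ i : B, ENNReal.ofReal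
        (1 - (r (c (Sum.inr i)) : ℝ) / ((cal c (c (Sum.inr i))).card + 1)) *
      ∫⁻ z, ENNReal.ofReal (1 + (residual c r i z : ℝ))⁻¹ ∂Measure.pi (fun u => ν (c u)) ≤ 1 := by
  calc _ ≤ ∑ i : B, ∫⁻ z, (lowEvent c (r (c (Sum.inr i))) i).indicator
        (fun z => ENNReal.ofReal (1 + (residual c r i z : ℝ))⁻¹) z
          ∂Measure.pi (fun u => ν (c u)) :=
        Finset.sum_le_sum fun i _ => mul_lintegral_le_lowEvent ν i (hr _)
          (measurable_inv_residual r i) fun w hw z => by rw [residual_swap r hw]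
    _ = ∫⁻ z, ∑ i : B, (lowEvent c (r (c (Sum.inr i))) i).indicator
        (fun z => ENNReal.ofReal (1 + (residual c r i z : ℝ))⁻¹) z
          ∂Measure.pi (fun u => ν (c u)) :=
        (lintegral_finsetSum _ fun i _ =>
          (measurable_inv_residual r i).indicator (measurableSet_lowEvent _ i)).symm
    _ ≤ ∫⁻ _z, 1 ∂Measure.pi (fun u => ν (c u)) := by
        refine lintegral_mono fun z => ?_
        -- `L` collects the `p`-values strictly above their thresholds. Its size is at most `1 +
        -- residual` for every `i`, so the sum over `L` is at most `L.card / L.card`.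
        set L := Finset.univ.filter fun j : B => r (c (Sum.inr j)) ≤
          exceed (cal c (c (Sum.inr j))) z (z (Sum.inr j)) with hL
        have h1 : ∑ i : B, (lowEvent c (r (c (Sum.inr i))) i).indicator
            (fun z => ENNReal.ofReal (1 + (residual c r i z : ℝ))⁻¹) z =
            ∑ i ∈ L, ENNReal.ofReal (1 + (residual c r i z : ℝ))⁻¹ := by
          rw [hL, Finset.sum_filter]
          classical
          refine Finset.sum_congr rfl fun i _ => ?_
          rw [Set.indicator_apply]
          exact if_congr Iff.rfl rfl rfl
        simp only [h1]
        rcases L.eq_empty_or_nonempty with h | h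
        · simp [h]
        have hpos : (0 : ℝ) < L.card := by exact_mod_cast h.card_pos
        calc _ ≤ ∑ _i ∈ L, ENNReal.ofReal (L.card : ℝ)⁻¹ := by
              refine Finset.sum_le_sum fun i _ => ENNReal.ofReal_le_ofReal (inv_anti₀ hpos ?_)
              exact_mod_cast card_above_le r i z
          _ = 1 := by
              rw [Finset.sum_const, nsmul_eq_mul, ENNReal.ofReal_inv_of_pos hpos,
                ENNReal.ofReal_natCast]
              exact ENNReal.mul_inv_cancel (by exact_mod_cast h.card_pos.ne')
                (ENNReal.natCast_ne_top _)
    _ = 1 := by simp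

/-- The level of the adaptive step-up procedure under exchangeability within the pools. -/
theorem measure_stepUp_pos_le (r : κ → ℕ) {C α : ℝ} (hC : 0 < C) (hα : 0 ≤ α)
    (h : ∑ i : B, ∫⁻ z, ENNReal.ofReal (1 + (residual c r i z : ℝ))⁻¹
      ∂Measure.pi (fun u => ν (c u)) ≤ ENNReal.ofReal C) :
    Measure.pi (fun u => ν (c u))
      {z | 0 < stepUp (C * (1 + aboveCount c r z)) α (trueP c z)} ≤ ENNReal.ofReal α := by
  set π := Measure.pi (fun u => ν (c u)) with hπ
  let R : (A ⊕ B → ℝ) → ℕ := fun z => stepUp (C * (1 + aboveCount c r z)) α (trueP c z)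
  let f : B → (A ⊕ B → ℝ) → ℝ := fun i z =>
    if 0 < R z ∧ C * (1 + aboveCount c r z) * trueP c z i ≤ α * R z then (R z : ℝ)⁻¹ else 0
  have hRord : ∀ z z' : A ⊕ B → ℝ, (∀ v w, z v ≤ z w ↔ z' v ≤ z' w) → R z = R z' := by
    intro z z' hz
    have : trueP c z = trueP c z' := funext fun i => trueP_eq_of_order hz i
    simp only [R, this, aboveCount_eq_of_order r hz]
  have hRmeas : Measurable R := measurable_of_order hRord
  have hfmeas : ∀ i, Measurable (f i) := fun i => measurable_of_order fun z z' hz => by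
    simp only [f, hRord z z' hz, aboveCount_eq_of_order r hz, trueP_eq_of_order hz i]
  have hf0 : ∀ i z, 0 ≤ f i z := fun i z => by simp only [f]; split_ifs <;> positivity
  have hone : ∀ i, ∫⁻ z, ENNReal.ofReal (f i z) ∂π ≤ ENNReal.ofReal (α / C) *
      ∫⁻ z, ENNReal.ofReal (1 + (residual c r i z : ℝ))⁻¹ ∂π := by
    intro i
    have hcard := card_pool (c := c) i
    have h1 := card_pool_mul_lintegral (c := c) ν i (hfmeas i).ennreal_ofReal
    have h2 : ((pool c i).card : ℝ≥0∞) * ∫⁻ z, ENNReal.ofReal (f i z) ∂π ≤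
        ((pool c i).card : ℝ≥0∞) * (ENNReal.ofReal (α / C) *
          ∫⁻ z, ENNReal.ofReal (1 + (residual c r i z : ℝ))⁻¹ ∂π) := by
      rw [h1, ← lintegral_const_mul _ (measurable_inv_residual r i),
        ← lintegral_const_mul _ ((measurable_inv_residual r i).const_mul _)]
      refine lintegral_mono fun z => ?_
      simp only
      rw [← ENNReal.ofReal_sum_of_nonneg fun w _ => hf0 i _, ← ENNReal.ofReal_mul (by positivity),
        ← ENNReal.ofReal_natCast, ← ENNReal.ofReal_mul (by positivity)]
      refine ENNReal.ofReal_le_ofReal ?_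
      have hnn : 0 ≤ ((pool c i).card : ℝ) * (α / C * (1 + (residual c r i z : ℝ))⁻¹) := by
        positivity
      -- The scores `z` are now fixed and only the member placed at position `i` varies. The
      -- constant in the step-up bound must not depend on it, which is why `aboveCount` is replaced
      -- by the swap-invariant `residual`.
      refine le_trans (Finset.sum_le_sum fun w hw => ?_) (sum_inv_of_exceed_le (pool c i) z
        (fun w => R (z ∘ Equiv.swap (Sum.inr i) w)) hnn fun w hw w' hw' hz => ?_)
      · set z' := z ∘ Equiv.swap (Sum.inr i) w with hz'
        have hrank : exceed (pool c i) z (z w) =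
            1 + exceed (cal c (c (Sum.inr i))) z' (z' (Sum.inr i)) := by
          have := exceed_pool_self (c := c) z' i
          rw [hz', exceed_pool_swap hw] at this
          rw [add_comm, ← this]
          simp
        by_cases hcond : 0 < R z' ∧ C * (1 + aboveCount c r z') * trueP c z' i ≤ α * R z'
        · have hle : (exceed (pool c i) z (z w) : ℝ) ≤
              ((pool c i).card : ℝ) * (α / C * (1 + (residual c r i z : ℝ))⁻¹) * R z' := by
            have h3 : C * (1 + residual c r i z) * trueP c z' i ≤ α * R z' := by
              refine le_trans ?_ hcond.2
              have h4 : (residual c r i z : ℝ) ≤ aboveCount c r z' := by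
                rw [← residual_swap r hw z]
                exact_mod_cast residual_le_aboveCount r i z'
              have := trueP_nonneg (c := c) z' i
              gcongr
            have h5 : trueP c z' i = (exceed (pool c i) z (z w) : ℝ) / (pool c i).card := by
              rw [trueP, hrank, hcard]; push_cast; rfl
            have hP : (0 : ℝ) < (pool c i).card := by rw [hcard]; positivity
            have hT : (0 : ℝ) < 1 + (residual c r i z : ℝ) := by positivity
            rw [h5] at h3
            have e : ((pool c i).card : ℝ) * (α / C * (1 + (residual c r i z : ℝ))⁻¹) * R z' =
                (α * R z') * ((pool c i).card / (C * (1 + residual c r i z))) := by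
              field_simp
            rw [e]
            calc (exceed (pool c i) z (z w) : ℝ) = (C * (1 + residual c r i z) *
                  ((exceed (pool c i) z (z w) : ℝ) / (pool c i).card)) *
                  ((pool c i).card / (C * (1 + residual c r i z))) := by field_simp
              _ ≤ _ := by gcongr
          simp only [f, if_pos hcond, if_pos (And.intro hcond.1 hle)]
          exact le_rfl
        · simp only [f, if_neg hcond]
          split_ifs <;> positivity
      · refine stepUp_anti (by positivity) ?_ (fun j => trueP_nonneg _ j)
          (fun j => trueP_swap_anti hw hw' z hz j)
        have := aboveCount_swap_anti r hw hw' z hz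
        gcongr
    rwa [ENNReal.mul_le_mul_iff_right (by simp [hcard]) (ENNReal.natCast_ne_top _)] at h2
  have hset : MeasurableSet {z | 0 < R z} := hRmeas (measurableSet_Ioi (a := 0))
  calc π {z | 0 < R z} = ∫⁻ z, Set.indicator {z | 0 < R z} 1 z ∂π := by
        rw [lintegral_indicator_one hset]
    _ ≤ ∫⁻ z, ∑ i, ENNReal.ofReal (f i z) ∂π := by
        refine lintegral_mono fun z => ?_
        by_cases hz : 0 < R z
        · rw [Set.indicator_of_mem (by exact hz), ← ENNReal.ofReal_sum_of_nonneg fun i _ => hf0 i z,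
            Pi.one_apply, ← ENNReal.ofReal_one]
          exact ENNReal.ofReal_le_ofReal (one_le_sum_stepUp hz)
        · rw [Set.indicator_of_notMem (by exact hz)]
          exact zero_le
    _ = ∑ i, ∫⁻ z, ENNReal.ofReal (f i z) ∂π :=
        lintegral_finsetSum _ fun i _ => (hfmeas i).ennreal_ofReal
    _ ≤ ENNReal.ofReal (α / C) *
        ∑ i, ∫⁻ z, ENNReal.ofReal (1 + (residual c r i z : ℝ))⁻¹ ∂π := by
        rw [Finset.mul_sum]
        exact Finset.sum_le_sum fun i _ => hone i
    _ ≤ ENNReal.ofReal (α / C) * ENNReal.ofReal C := by gcongr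
    _ = ENNReal.ofReal α := by
        rw [← ENNReal.ofReal_mul (by positivity), div_mul_cancel₀ _ hC.ne']

end Swaps

/-! ### Geometric means and integrals over the unit interval. -/

section Mean

variable {ι : Type*}

/-- AM-GM is applied both to the `1 - p j * e` and to the `p j * e`; the two arithmetic means add up
to 1. -/
lemma prod_one_sub_mul_le (s : Finset ι) (hs : s.Nonempty) (p : ι → ℝ)
    (hp : ∀ j ∈ s, 0 ≤ p j ∧ p j ≤ 1) {e : ℝ} (he0 : 0 ≤ e) (he1 : e ≤ 1) :
    ∏ j ∈ s, (1 - p j * e) ≤ (1 - (∏ j ∈ s, p j ^ (1 / (s.card : ℝ))) * e) ^ s.card := by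
  have hM : (0 : ℝ) < s.card := by exact_mod_cast hs.card_pos
  have hw : ∑ _j ∈ s, (1 / (s.card : ℝ)) = 1 := by
    rw [Finset.sum_const, nsmul_eq_mul]; field_simp
  have hq : ∀ j ∈ s, 0 ≤ 1 - p j * e := fun j hj => by nlinarith [hp j hj]
  have h1 := Real.geom_mean_le_arith_mean_weighted s (fun _ => 1 / (s.card : ℝ))
    (fun j => 1 - p j * e) (fun _ _ => by positivity) hw hq
  have h2 := Real.geom_mean_le_arith_mean_weighted s (fun _ => 1 / (s.card : ℝ))
    (fun j => p j * e) (fun _ _ => by positivity) hw (fun j hj => mul_nonneg (hp j hj).1 he0)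
  have h3 : ∏ j ∈ s, (p j * e) ^ (1 / (s.card : ℝ)) =
      (∏ j ∈ s, p j ^ (1 / (s.card : ℝ))) * e := by
    rw [Finset.prod_congr rfl fun j hj => Real.mul_rpow (hp j hj).1 he0, Finset.prod_mul_distrib,
      Finset.prod_const, ← Real.rpow_natCast, ← Real.rpow_mul he0, one_div,
      inv_mul_cancel₀ hM.ne', Real.rpow_one]
  have h4 : ∏ j ∈ s, (1 - p j * e) ^ (1 / (s.card : ℝ)) ≤
      1 - (∏ j ∈ s, p j ^ (1 / (s.card : ℝ))) * e := by
    have h5 : ∑ j ∈ s, 1 / (s.card : ℝ) * (1 - p j * e) +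
        ∑ j ∈ s, 1 / (s.card : ℝ) * (p j * e) = 1 := by
      rw [← Finset.sum_add_distrib]
      refine Eq.trans ?_ hw
      exact Finset.sum_congr rfl fun _ _ => by ring
    rw [h3] at h2
    linarith
  calc ∏ j ∈ s, (1 - p j * e) = (∏ j ∈ s, (1 - p j * e) ^ (1 / (s.card : ℝ))) ^ s.card := by
        rw [← Finset.prod_pow]
        refine Finset.prod_congr rfl fun j hj => ?_
        rw [← Real.rpow_natCast, ← Real.rpow_mul (hq j hj), one_div, inv_mul_cancel₀ hM.ne',
          Real.rpow_one]
    _ ≤ _ := pow_le_pow_left₀ (Finset.prod_nonneg fun j hj => Real.rpow_nonneg (hq j hj) _) h4 _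

lemma lintegral_Ioc_eq_intervalIntegral {f : ℝ → ℝ} (hf : Continuous f)
    (h0 : ∀ t ∈ Set.Ioc (0 : ℝ) 1, 0 ≤ f t) :
    ∫⁻ t in Set.Ioc (0 : ℝ) 1, ENNReal.ofReal (f t) = ENNReal.ofReal (∫ t in (0 : ℝ)..1, f t) := by
  rw [intervalIntegral.integral_of_le zero_le_one, ofReal_integral_eq_lintegral_ofReal]
  · exact hf.integrableOn_Ioc
  · exact (ae_restrict_iff' measurableSet_Ioc).2 (Filter.Eventually.of_forall h0)

/-- Replaces the inverse of a count by powers, whose expectation factorizes over independent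
indicators. -/
lemma lintegral_pow_Ioc (T : ℕ) :
    ∫⁻ t in Set.Ioc (0 : ℝ) 1, ENNReal.ofReal (t ^ T) = ENNReal.ofReal (1 + (T : ℝ))⁻¹ := by
  rw [lintegral_Ioc_eq_intervalIntegral (continuous_pow T) fun t ht => pow_nonneg ht.1.le T,
    integral_pow]
  simp [add_comm]

lemma lintegral_pow_one_sub_le {g : ℝ} (hg0 : 0 ≤ g) (hg1 : g ≤ 1) (M : ℕ) :
    ∫⁻ t in Set.Ioc (0 : ℝ) 1, ENNReal.ofReal ((1 - g * (1 - t)) ^ M) ≤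
      ENNReal.ofReal ((M : ℝ) + 1)⁻¹ * (ENNReal.ofReal g)⁻¹ := by
  -- For `g = 0` the right-hand side is `∞`.
  rcases hg0.eq_or_lt with rfl | hg
  · rw [ENNReal.ofReal_zero, ENNReal.inv_zero, ENNReal.mul_top]
    · exact le_top
    · simp only [ne_eq, ENNReal.ofReal_eq_zero, not_le]; positivity
  rw [lintegral_Ioc_eq_intervalIntegral (by fun_prop)
    fun t ht => pow_nonneg (by nlinarith [ht.1, ht.2]) M,
    ← ENNReal.ofReal_inv_of_pos hg, ← ENNReal.ofReal_mul (by positivity)]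
  refine ENNReal.ofReal_le_ofReal ?_
  have hd : ∀ t ∈ Set.uIcc (0 : ℝ) 1, HasDerivAt
      (fun t => ((M : ℝ) + 1)⁻¹ * g⁻¹ * (1 - g * (1 - t)) ^ (M + 1)) ((1 - g * (1 - t)) ^ M) t := by
    intro t _
    have h1 : HasDerivAt (fun t : ℝ => 1 - g * (1 - t)) g t := by
      have := (((hasDerivAt_id t).const_sub 1).const_mul g).const_sub 1
      simpa using this
    have h2 := (h1.pow (M + 1)).const_mul (((M : ℝ) + 1)⁻¹ * g⁻¹)
    refine h2.congr_deriv ?_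
    have : (M : ℝ) + 1 ≠ 0 := by positivity
    rw [Nat.add_sub_cancel]
    push_cast
    field_simp
  rw [intervalIntegral.integral_eq_sub_of_hasDerivAt hd
    (Continuous.intervalIntegrable (by fun_prop) _ _)]
  -- The primitive at 0 is nonnegative and may be dropped.
  have : 0 ≤ ((M : ℝ) + 1)⁻¹ * g⁻¹ * (1 - g * (1 - 0)) ^ (M + 1) :=
    mul_nonneg (by positivity) (pow_nonneg (by linarith) _)
  simp only [sub_self, mul_zero, sub_zero, one_pow, mul_one] at this ⊢
  linarith

end Mean

/-! ### Conditional independence and the geometric-mean bound. -/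

section Resampling

variable {A B κ : Type*} [Fintype A] [Fintype B] [DecidableEq A] [DecidableEq B] [DecidableEq κ]
  {c : A ⊕ B → κ} (ν : κ → Measure ℝ) [∀ k, IsProbabilityMeasure (ν k)]

/-- Fubini for a single coordinate: an independent redraw of it leaves the integral unchanged. -/
lemma lintegral_pi_update {f : (A ⊕ B → ℝ) → ℝ≥0∞} (hf : Measurable f) (a : A ⊕ B) :
    ∫⁻ z, f z ∂Measure.pi (fun u => ν (c u)) =
      ∫⁻ z, ∫⁻ x, f (Function.update z a x) ∂ν (c a) ∂Measure.pi (fun u => ν (c u)) := by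
  have h := lmarginal_singleton (μ := fun u => ν (c u)) f a
  have hm : Measurable fun z => ∫⁻ x, f (Function.update z a x) ∂ν (c a) := by
    rw [← h]; exact hf.lmarginal _
  refine lintegral_eq_of_lmarginal_eq {a} hf hm ?_
  rw [h, lmarginal_singleton]
  funext z
  simp

lemma measurable_exceed (T : Finset (A ⊕ B)) :
    Measurable fun q : (A ⊕ B → ℝ) × ℝ => exceed T q.1 q.2 := by
  simp only [exceed, Finset.card_filter]
  refine Finset.measurable_sum _ fun v _ => ?_
  refine Measurable.ite (measurableSet_le measurable_snd ?_) measurable_const measurable_const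
  exact (measurable_pi_apply v).comp measurable_fst

lemma measurable_measure_le_exceed (T : Finset (A ⊕ B)) (r : ℕ) (k : κ) :
    Measurable fun z => ν k {x | r ≤ exceed T z x} :=
  measurable_measure_prodMk_left (measurable_exceed T (measurableSet_Ici (a := r)))

lemma exceed_update {T : Finset (A ⊕ B)} {a : A ⊕ B} (ha : a ∉ T) (z : A ⊕ B → ℝ) (x s : ℝ) :
    exceed T (Function.update z a x) s = exceed T z s :=
  exceed_congr (fun v hv => Function.update_of_ne (by rintro rfl; exact ha hv) _ _) s

/-- The expected inverse of the conditional probability that a new score has rank larger than `r`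
with respect to the pool of `i`. -/
lemma lintegral_inv_measure_le_exceed {r : ℕ} (i : B)
    (hr : r ≤ (cal c (c (Sum.inr i))).card) :
    ∫⁻ z, (ν (c (Sum.inr i)) {x | r ≤ exceed (pool c i) z x})⁻¹
        ∂Measure.pi (fun u => ν (c u)) ≤
      ENNReal.ofReal (1 / (1 - (r : ℝ) / ((cal c (c (Sum.inr i))).card + 1))) := by
  set k := c (Sum.inr i) with hk
  have hpos : 0 < 1 - (r : ℝ) / ((cal c k).card + 1) := by
    rw [sub_pos, div_lt_one (by positivity)]
    have : (r : ℝ) ≤ (cal c k).card := by exact_mod_cast hr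
    linarith
  have hm := (measurable_measure_le_exceed (A := A) (B := B) ν (cal c k) r k).inv
  have hlow : Measurable fun z => (lowEvent c r i).indicator
      (fun z => (ν k {x | r ≤ exceed (cal c k) z x})⁻¹) z :=
    hm.indicator (measurableSet_lowEvent r i)
  -- The count over the whole pool makes the integrand swap-invariant, so the factor `1 - r / (N +
  -- 1)` can be exchanged for the event that `i` has a large rank.
  have h1 := mul_lintegral_le_lowEvent ν i hr
    (measurable_measure_le_exceed ν (pool c i) r k).inv
    (fun w hw z => by simp only [Pi.inv_apply, exceed_pool_swap hw])
  have h2 : ∫⁻ z, (lowEvent c r i).indicator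
      (fun z => (ν k {x | r ≤ exceed (pool c i) z x})⁻¹) z ∂Measure.pi (fun u => ν (c u)) ≤ 1 := by
    calc _ ≤ ∫⁻ z, (lowEvent c r i).indicator
          (fun z => (ν k {x | r ≤ exceed (cal c k) z x})⁻¹) z ∂Measure.pi (fun u => ν (c u)) := by
          -- Shrinking the pool to the calibration sample increases the inverse and makes it
          -- independent of the score of `i`.
          refine lintegral_mono fun z => Set.indicator_le_indicator (ENNReal.inv_le_inv.2 ?_)
          exact measure_mono fun x hx => le_trans hx (exceed_mono (cal_subset_pool i) z x)
      _ ≤ ∫⁻ _z, 1 ∂Measure.pi (fun u => ν (c u)) := by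
          -- Redrawing the score of `i`, the event has exactly the conditional probability that is
          -- inverted.
          rw [lintegral_pi_update ν hlow (Sum.inr i)]
          refine lintegral_mono fun z => ?_
          have : ∀ x, (lowEvent c r i).indicator
              (fun z => (ν k {x | r ≤ exceed (cal c k) z x})⁻¹)
                (Function.update z (Sum.inr i) x) =
              {x | r ≤ exceed (cal c k) z x}.indicator
                (fun _ => (ν k {x | r ≤ exceed (cal c k) z x})⁻¹) x := by
            intro x
            simp only [Set.indicator, lowEvent, Set.mem_ofPred_eq, Function.update_self,
              exceed_update (inr_notMem_cal _ i), ← hk]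
          simp only [this]
          rw [lintegral_indicator_const]
          · exact ENNReal.inv_mul_le_one _
          · exact (measurable_exceed (cal c k)).comp measurable_prodMk_left
              (measurableSet_Ici (a := r))
      _ = 1 := by simp
  rw [one_div, ENNReal.ofReal_inv_of_pos hpos, ENNReal.le_inv_iff_mul_le, mul_comm]
  exact h1.trans h2

lemma measurableSet_residualAbove (r : κ → ℕ) (i j : B) :
    MeasurableSet {q : (A ⊕ B → ℝ) × ℝ | residualAbove c r i q.1 j q.2} := by
  unfold residualAbove
  split_ifs with h
  · exact measurable_exceed (pool c i) (measurableSet_Ici (a := r (c (Sum.inr j))))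
  · exact (measurable_exceed _).const_add 1 (measurableSet_Ici (a := r (c (Sum.inr j))))

lemma residualAbove_update (r : κ → ℕ) (i j : B) {l : B} (hl : l ≠ i) (z : A ⊕ B → ℝ) (x s : ℝ) :
    residualAbove c r i (Function.update z (Sum.inr l) x) j s ↔ residualAbove c r i z j s := by
  have hp : Sum.inr l ∉ pool c i := fun h => inr_ne_of_mem_pool hl h rfl
  unfold residualAbove
  rw [exceed_update hp, exceed_update (inr_notMem_cal _ l)]

/-- Conditionally on the calibration sample and on the score of `i`, the other test scores are
independent. -/
lemma lintegral_mul_prod_residual (r : κ → ℕ) (i : B) (t : ℝ≥0∞) (s : Finset B) (hs : i ∉ s)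
    {G : (A ⊕ B → ℝ) → ℝ≥0∞} (hG : Measurable G)
    (hGs : ∀ j ∈ s, ∀ z x, G (Function.update z (Sum.inr j) x) = G z) :
    ∫⁻ z, G z * ∏ j ∈ s, (if residualAbove c r i z j (z (Sum.inr j)) then t else 1)
        ∂Measure.pi (fun u => ν (c u)) =
      ∫⁻ z, G z * ∏ j ∈ s, ∫⁻ x, (if residualAbove c r i z j x then t else 1)
          ∂ν (c (Sum.inr j)) ∂Measure.pi (fun u => ν (c u)) := by
  have hH : ∀ j, Measurable fun z : A ⊕ B → ℝ =>
      ∫⁻ x, (if residualAbove c r i z j x then t else 1) ∂ν (c (Sum.inr j)) := fun j =>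
    Measurable.lintegral_prod_right' (f := fun q : (A ⊕ B → ℝ) × ℝ =>
      if residualAbove c r i q.1 j q.2 then t else 1)
      (Measurable.ite (measurableSet_residualAbove r i j) measurable_const measurable_const)
  have hh : ∀ j, Measurable fun z : A ⊕ B → ℝ =>
      if residualAbove c r i z j (z (Sum.inr j)) then t else 1 := fun j =>
    measurable_of_order fun z z' h => by simp only [residualAbove_iff_of_order r i h]
  induction s using Finset.induction_on generalizing G with
  | empty => simp
  | insert a s ha ih =>
    have hai : a ≠ i := by rintro rfl; exact hs (Finset.mem_insert_self _ _)
    have hsi : i ∉ s := fun h => hs (Finset.mem_insert_of_mem h)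
    have hne : ∀ j ∈ s, j ≠ i := fun j hj => by rintro rfl; exact hsi hj
    -- The factor of `a` is absorbed into `G`, the induction hypothesis integrates out the others,
    -- and the score of `a` is redrawn last.
    have h1 := ih hsi (hG.mul (hh a)) fun j hj z x => by
      have hja : (Sum.inr a : A ⊕ B) ≠ Sum.inr j := by
        rintro h; rw [Sum.inr.injEq] at h; exact ha (h ▸ hj)
      simp only [Pi.mul_apply, hGs j (Finset.mem_insert_of_mem hj),
        residualAbove_update r i a (hne j hj), Function.update_of_ne hja]
    simp only [Pi.mul_apply] at h1
    simp only [Finset.prod_insert ha, ← mul_assoc]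
    rw [h1]
    refine (lintegral_pi_update ν ((hG.mul (hh a)).mul
      (Finset.measurable_fun_prod s fun j _ => hH j)) (Sum.inr a)).trans ?_
    refine lintegral_congr fun z => ?_
    simp only [Pi.mul_apply, hGs a (Finset.mem_insert_self _ _), residualAbove_update r i _ hai,
      Function.update_self]
    rw [lintegral_mul_const, lintegral_const_mul]
    all_goals
      have : Measurable fun x => if residualAbove c r i z a x then t else 1 :=
        Measurable.ite (measurable_prodMk_left (measurableSet_residualAbove r i a))
          measurable_const measurable_const
    · exact this
    · exact this.const_mul _

lemma lintegral_ite_residualAbove (r : κ → ℕ) (i j : B) (z : A ⊕ B → ℝ) {t : ℝ} (ht : 0 ≤ t) :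
    ∫⁻ x, (if residualAbove c r i z j x then ENNReal.ofReal t else 1) ∂ν (c (Sum.inr j)) =
      ENNReal.ofReal
        (1 - (ν (c (Sum.inr j))).real {x | residualAbove c r i z j x} * (1 - t)) := by
  set U := {x | residualAbove c r i z j x} with hU
  have hUm : MeasurableSet U := measurable_prodMk_left (measurableSet_residualAbove r i j)
  have h1 : ∀ x, (if residualAbove c r i z j x then ENNReal.ofReal t else 1) =
      U.indicator (fun _ => ENNReal.ofReal t) x + Uᶜ.indicator (fun _ => 1) x := by
    intro x
    by_cases hx : residualAbove c r i z j x
    · have : x ∈ U := hx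
      simp [hx, this]
    · have : x ∉ U := hx
      simp [hx, this]
  simp only [h1]
  rw [lintegral_add_left (measurable_const.indicator hUm), lintegral_indicator_const hUm,
    lintegral_indicator_const hUm.compl, ← ofReal_measureReal, ← ofReal_measureReal,
    probReal_compl_eq_one_sub hUm, one_mul, ← ENNReal.ofReal_mul ht, ← ENNReal.ofReal_add]
  · congr 1; ring
  · positivity
  · linarith [measureReal_le_one (μ := ν (c (Sum.inr j))) (s := U)]

/-- For a test point in the class of `i` the count runs over the pool of `i`. For another class, the
`1 +` dominates the contribution of the score of `j`, so the pool of `j` can be used instead. -/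
lemma lintegral_inv_measure_residualAbove (r : κ → ℕ) (hr : ∀ k, r k ≤ (cal c k).card)
    (i j : B) :
    ∫⁻ z, (ν (c (Sum.inr j)) {x | residualAbove c r i z j x})⁻¹
        ∂Measure.pi (fun u => ν (c u)) ≤
      ENNReal.ofReal (1 / (1 - (r (c (Sum.inr j)) : ℝ) /
        ((cal c (c (Sum.inr j))).card + 1))) := by
  by_cases h : c (Sum.inr j) = c (Sum.inr i)
  · refine le_trans (le_of_eq ?_) (h ▸ lintegral_inv_measure_le_exceed ν i (hr _))
    simp only [residualAbove, h, if_true]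
  · refine le_trans (lintegral_mono fun z => ENNReal.inv_le_inv.2 (measure_mono fun x hx => ?_))
      (lintegral_inv_measure_le_exceed ν j (hr _))
    simp only [residualAbove, h, if_false, Set.mem_ofPred_eq] at hx ⊢
    rw [exceed_pool] at hx
    refine hx.trans ?_
    split_ifs <;> omega

/-- The expected inverse of a leave-one-out count is bounded by a geometric mean over the other
test indices. -/
theorem lintegral_inv_residual_le (r : κ → ℕ) (hr : ∀ k, r k ≤ (cal c k).card) (i : B)
    (hB : 2 ≤ Fintype.card B) :
    ∫⁻ z, ENNReal.ofReal (1 + (residual c r i z : ℝ))⁻¹ ∂Measure.pi (fun u => ν (c u)) ≤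
      ENNReal.ofReal ((Fintype.card B : ℝ)⁻¹ * ∏ j ∈ Finset.univ.erase i,
        (1 / (1 - (r (c (Sum.inr j)) : ℝ) / ((cal c (c (Sum.inr j))).card + 1))) ^
          (1 / ((Fintype.card B : ℝ) - 1))) := by
  set π := Measure.pi (fun u => ν (c u)) with hπ
  set s := Finset.univ.erase i with hs
  have hcard : s.card = Fintype.card B - 1 := by
    rw [hs, Finset.card_erase_of_mem (Finset.mem_univ i), Finset.card_univ]
  have hcardR : (s.card : ℝ) = (Fintype.card B : ℝ) - 1 := by
    rw [hcard]; push_cast [show 1 ≤ Fintype.card B by omega]; ring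
  have hsne : s.Nonempty := by rw [← Finset.card_pos]; omega
  have hM : (0 : ℝ) < s.card := by exact_mod_cast hsne.card_pos
  let q : B → (A ⊕ B → ℝ) → ℝ≥0∞ := fun j z => ν (c (Sum.inr j)) {x | residualAbove c r i z j x}
  have hqm : ∀ j, Measurable (q j) := fun j =>
    measurable_measure_prodMk_left (measurableSet_residualAbove r i j)
  have hqr : ∀ j z, 0 ≤ (q j z).toReal ∧ (q j z).toReal ≤ 1 := fun j z =>
    ⟨ENNReal.toReal_nonneg, measureReal_le_one⟩
  have hresm := measurable_residual (A := A) (B := B) (c := c) r i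
  have hpoint : ∀ z, ∫⁻ t in Set.Ioc (0 : ℝ) 1, ∏ j ∈ s,
      ∫⁻ x, (if residualAbove c r i z j x then ENNReal.ofReal t else 1) ∂ν (c (Sum.inr j)) ≤
      ENNReal.ofReal (Fintype.card B : ℝ)⁻¹ * ∏ j ∈ s, (q j z)⁻¹ ^ (1 / (s.card : ℝ)) := by
    intro z
    -- `g` is the geometric mean of the conditional probabilities `q j z`.
    set g := ∏ j ∈ s, (q j z).toReal ^ (1 / (s.card : ℝ)) with hg
    have hg0 : 0 ≤ g := Finset.prod_nonneg fun j _ => Real.rpow_nonneg (hqr j z).1 _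
    have hg1 : g ≤ 1 := Finset.prod_le_one (fun j _ => Real.rpow_nonneg (hqr j z).1 _)
      fun j _ => Real.rpow_le_one (hqr j z).1 (hqr j z).2 (by positivity)
    have hginv : (ENNReal.ofReal g)⁻¹ = ∏ j ∈ s, (q j z)⁻¹ ^ (1 / (s.card : ℝ)) := by
      have hfac : ∀ j, ENNReal.ofReal ((q j z).toReal ^ (1 / (s.card : ℝ))) =
          q j z ^ (1 / (s.card : ℝ)) := fun j => by
        rw [← ENNReal.ofReal_rpow_of_nonneg (hqr j z).1 (by positivity),
          ENNReal.ofReal_toReal (measure_ne_top _ _)]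
      rw [hg, ENNReal.ofReal_prod_of_nonneg fun j _ => Real.rpow_nonneg (hqr j z).1 _,
        ENNReal.prod_inv_distrib]
      · exact Finset.prod_congr rfl fun j _ => by rw [hfac, ENNReal.inv_rpow]
      · intro a _ b _ _
        exact Or.inr ENNReal.ofReal_ne_top
    calc _ ≤ ∫⁻ t in Set.Ioc (0 : ℝ) 1, ENNReal.ofReal ((1 - g * (1 - t)) ^ s.card) := by
          refine setLIntegral_mono' measurableSet_Ioc fun t ht => ?_
          rw [Finset.prod_congr rfl fun j _ =>
            lintegral_ite_residualAbove ν r i j z ht.1.le, ← ENNReal.ofReal_prod_of_nonneg]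
          · exact ENNReal.ofReal_le_ofReal (prod_one_sub_mul_le s hsne (fun j => (q j z).toReal)
              (fun j _ => hqr j z) (by linarith [ht.2]) (by linarith [ht.1]))
          · intro j _
            have := hqr j z
            have h2 : (ν (c (Sum.inr j))).real {x | residualAbove c r i z j x} ≤ 1 :=
              measureReal_le_one
            have h3 : 0 ≤ (ν (c (Sum.inr j))).real {x | residualAbove c r i z j x} :=
              measureReal_nonneg
            nlinarith [ht.1, ht.2]
      _ ≤ _ := lintegral_pow_one_sub_le hg0 hg1 s.card
      _ = _ := by rw [hginv, hcardR, sub_add_cancel]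
  have hpow : ∀ t : ℝ, 0 ≤ t → ∫⁻ z, ENNReal.ofReal (t ^ residual c r i z) ∂π =
      ∫⁻ z, ∏ j ∈ s, ∫⁻ x, (if residualAbove c r i z j x then ENNReal.ofReal t else 1)
        ∂ν (c (Sum.inr j)) ∂π := by
    intro t ht
    have h1 := lintegral_mul_prod_residual (c := c) ν r i (ENNReal.ofReal t) s
      (Finset.notMem_erase _ _) (G := fun _ => 1) measurable_const (fun _ _ _ _ => rfl)
    simp only [one_mul] at h1
    rw [← h1]
    refine lintegral_congr fun z => ?_
    rw [Finset.prod_ite, Finset.prod_const, Finset.prod_const_one, mul_one, ENNReal.ofReal_pow ht]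
    rfl
  have hjoint : Measurable fun w : (A ⊕ B → ℝ) × ℝ => ENNReal.ofReal (w.2 ^ residual c r i w.1) :=
    (measurable_snd.pow (hresm.comp measurable_fst)).ennreal_ofReal
  have hjoint' : Measurable fun w : (A ⊕ B → ℝ) × ℝ => ∏ j ∈ s,
      ∫⁻ x, (if residualAbove c r i w.1 j x then ENNReal.ofReal w.2 else 1)
        ∂ν (c (Sum.inr j)) := by
    refine Finset.measurable_fun_prod s fun j _ => ?_
    refine Measurable.lintegral_prod_right' (f := fun w : ((A ⊕ B → ℝ) × ℝ) × ℝ =>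
      if residualAbove c r i w.1.1 j w.2 then ENNReal.ofReal w.1.2 else 1) ?_
    refine Measurable.ite ?_ (measurable_snd.comp measurable_fst).ennreal_ofReal measurable_const
    exact ((measurable_fst.comp measurable_fst).prodMk measurable_snd)
      (measurableSet_residualAbove r i j)
  have hlam : ∀ j, 0 ≤ 1 / (1 - (r (c (Sum.inr j)) : ℝ) / ((cal c (c (Sum.inr j))).card + 1)) := by
    intro j
    have : (r (c (Sum.inr j)) : ℝ) ≤ (cal c (c (Sum.inr j))).card := by exact_mod_cast hr _
    refine one_div_nonneg.2 (sub_nonneg.2 ((div_le_one (by positivity)).2 (by linarith)))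
  calc ∫⁻ z, ENNReal.ofReal (1 + (residual c r i z : ℝ))⁻¹ ∂π
      = ∫⁻ z, (∫⁻ t in Set.Ioc (0 : ℝ) 1, ENNReal.ofReal (t ^ residual c r i z)) ∂π := by
        simp only [lintegral_pow_Ioc]
    _ = ∫⁻ t in Set.Ioc (0 : ℝ) 1, (∫⁻ z, ENNReal.ofReal (t ^ residual c r i z) ∂π) :=
        lintegral_lintegral_swap (f := fun z t => ENNReal.ofReal (t ^ residual c r i z))
          hjoint.aemeasurable
    _ = ∫⁻ t in Set.Ioc (0 : ℝ) 1, (∫⁻ z, ∏ j ∈ s,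
        ∫⁻ x, (if residualAbove c r i z j x then ENNReal.ofReal t else 1)
          ∂ν (c (Sum.inr j)) ∂π) :=
        setLIntegral_congr_fun measurableSet_Ioc fun t ht => hpow t ht.1.le
    _ = ∫⁻ z, (∫⁻ t in Set.Ioc (0 : ℝ) 1, ∏ j ∈ s,
        ∫⁻ x, (if residualAbove c r i z j x then ENNReal.ofReal t else 1)
          ∂ν (c (Sum.inr j))) ∂π :=
        (lintegral_lintegral_swap (f := fun z t => ∏ j ∈ s,
          ∫⁻ x, (if residualAbove c r i z j x then ENNReal.ofReal t else 1)
            ∂ν (c (Sum.inr j))) hjoint'.aemeasurable).symm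
    _ ≤ ∫⁻ z, ENNReal.ofReal (Fintype.card B : ℝ)⁻¹ *
        ∏ j ∈ s, (q j z)⁻¹ ^ (1 / (s.card : ℝ)) ∂π := lintegral_mono hpoint
    _ = ENNReal.ofReal (Fintype.card B : ℝ)⁻¹ *
        ∫⁻ z, ∏ j ∈ s, (q j z)⁻¹ ^ (1 / (s.card : ℝ)) ∂π :=
        lintegral_const_mul _ (Finset.measurable_fun_prod s fun j _ =>
          (hqm j).inv.pow_const _)
    _ ≤ ENNReal.ofReal (Fintype.card B : ℝ)⁻¹ *
        ∏ j ∈ s, (∫⁻ z, (q j z)⁻¹ ∂π) ^ (1 / (s.card : ℝ)) := by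
        gcongr
        -- Hölder's inequality with `s.card` equal exponents; no independence of the `q j` is
        -- needed.
        refine ENNReal.lintegral_prod_norm_pow_le s (f := fun j z => (q j z)⁻¹)
          (p := fun _ => 1 / (s.card : ℝ)) (fun j _ => (hqm j).inv.aemeasurable) ?_
          fun _ _ => by positivity
        rw [Finset.sum_const, nsmul_eq_mul]; field_simp
    _ ≤ ENNReal.ofReal (Fintype.card B : ℝ)⁻¹ * ∏ j ∈ s, ENNReal.ofReal
        (1 / (1 - (r (c (Sum.inr j)) : ℝ) / ((cal c (c (Sum.inr j))).card + 1))) ^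
          (1 / (s.card : ℝ)) := by
        gcongr with j _
        exact lintegral_inv_measure_residualAbove ν r hr i j
    _ = _ := by
        rw [ENNReal.ofReal_mul (by positivity),
          ENNReal.ofReal_prod_of_nonneg fun j _ => Real.rpow_nonneg (hlam j) _, ← hcardR]
        congr 1
        exact Finset.prod_congr rfl fun j _ =>
          ENNReal.ofReal_rpow_of_nonneg (hlam j) (by positivity)

end Resampling

/-! ### Thresholds on the grid of attainable `p`-values. -/

section Thresholds

/-- The bound by `N`, not `N + 1`, keeps `1 - r / (N + 1)` positive. -/
lemma floor_threshold {lam : ℝ} (hlam : lam ∈ Set.Ioo (0 : ℝ) 1) (N : ℕ) :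
    ⌊lam * ((N : ℝ) + 1)⌋₊ ≤ N ∧
      roundLevel lam N = (⌊lam * ((N : ℝ) + 1)⌋₊ : ℝ) / ((N : ℝ) + 1) ∧ roundLevel lam N ≤ lam := by
  have h0 : 0 ≤ lam * ((N : ℝ) + 1) := mul_nonneg hlam.1.le (by positivity)
  have h1 : lam * ((N : ℝ) + 1) < ((N + 1 : ℕ) : ℝ) := by
    push_cast
    nlinarith [hlam.2, (Nat.cast_nonneg N : (0 : ℝ) ≤ N)]
  refine ⟨Nat.lt_succ_iff.1 ((Nat.floor_lt h0).2 h1), ?_, ?_⟩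
  · rw [roundLevel, natCast_floor_eq_intCast_floor h0]
  · rw [roundLevel, div_le_iff₀ (by positivity)]
    exact Int.floor_le _

lemma exists_nat_threshold {lam : ℝ} (hlam : lam ∈ Set.Ioo (0 : ℝ) 1) {N : ℕ}
    (h : ∃ z : ℤ, ((N : ℝ) + 1) * lam = z) :
    ∃ r : ℕ, r ≤ N ∧ lam = (r : ℝ) / ((N : ℝ) + 1) := by
  obtain ⟨z, hz⟩ := h
  have hN : (0 : ℝ) < (N : ℝ) + 1 := by positivity
  have hz0 : 0 ≤ z := by
    have : (0 : ℝ) ≤ z := by rw [← hz]; exact mul_nonneg hN.le hlam.1.le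
    exact_mod_cast this
  lift z to ℕ using hz0
  refine ⟨z, ?_, ?_⟩
  · have : (z : ℝ) < ((N + 1 : ℕ) : ℝ) := by
      push_cast at hz ⊢
      nlinarith [hlam.2]
    exact Nat.lt_succ_iff.1 (by exact_mod_cast this)
  · rw [eq_div_iff hN.ne', mul_comm, hz]
    simp

end Thresholds

/-! ### From the Simes minimum to the step-up count. -/

section Simes

variable {m : ℕ}

lemma stepUp_pos_of_simesAdapt_le (hm : 1 ≤ m) {m₀ α : ℝ} (hm₀ : 0 ≤ m₀) {p : Fin m → ℝ}
    (h : simesAdapt m₀ p ≤ α) : 0 < stepUp m₀ α p := by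
  have : Nonempty (Fin m) := ⟨⟨0, hm⟩⟩
  obtain ⟨l, hl⟩ := exists_eq_ciInf_of_finite (f := fun l : Fin m =>
    m₀ * orderStat p l / ((l : ℝ) + 1))
  have hl' : m₀ * orderStat p l ≤ α * ((l : ℕ) + 1 : ℕ) := by
    have : m₀ * orderStat p l / ((l : ℝ) + 1) ≤ α := hl.trans_le h
    rw [div_le_iff₀ (by positivity)] at this
    simpa using this
  refine lt_of_lt_of_le (Nat.succ_pos (l : ℕ)) (le_stepUp ?_)
  -- If the minimum is attained at the 0-based index `l`, the `l + 1` smallest coordinates all meet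
  -- the bound with `k = l + 1`.
  calc (l : ℕ) + 1 = ((Finset.Iic l).map (Tuple.sort p).toEmbedding).card := by
        rw [Finset.card_map, Fin.card_Iic]
    _ ≤ _ := Finset.card_le_card fun i hi => by
        simp only [Finset.mem_map, Finset.mem_Iic, Equiv.coe_toEmbedding] at hi
        obtain ⟨j, hj, rfl⟩ := hi
        simp only [Finset.mem_filter, Finset.mem_univ, true_and]
        exact (mul_le_mul_of_nonneg_left (Tuple.monotone_sort p hj) hm₀).trans hl'

end Simes

/-! ### Coverage for independent scores, and the two choices of the constant. -/

section Scores

variable {A B κ : Type*} [Fintype A] [Fintype B] [DecidableEq A] [DecidableEq B] [DecidableEq κ]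

lemma exceed_cal (c : A ⊕ B → κ) (z : A ⊕ B → ℝ) (k : κ) (s : ℝ) :
    (exceed (cal c k) z s : ℝ) = ∑ j ∈ Finset.univ.filter fun j : A => c (Sum.inl j) = k,
      if s ≤ z (Sum.inl j) then (1 : ℝ) else 0 := by
  rw [exceed, cal, Finset.card_filter, Finset.sum_filter, Finset.sum_filter, Fintype.sum_sum_type]
  simp

lemma card_cal (c : A ⊕ B → κ) (k : κ) :
    (cal c k).card = (Finset.univ.filter fun j : A => c (Sum.inl j) = k).card := by
  rw [cal, Finset.card_filter, Finset.card_filter, Fintype.sum_sum_type]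
  simp

lemma sum_threshold_le (c : A ⊕ B → κ) (z : A ⊕ B → ℝ) (r : κ → ℕ) (t : κ → ℝ)
    (ht : ∀ k, t k = (r k : ℝ) / ((cal c k).card + 1)) :
    (∑ i : B, if t (c (Sum.inr i)) ≤ trueP c z i then (1 : ℝ) else 0) = aboveCount c r z := by
  rw [aboveCount, Finset.card_filter]
  push_cast
  refine Finset.sum_congr rfl fun i _ => if_congr ?_ rfl rfl
  rw [ht, trueP, div_le_div_iff_of_pos_right (by positivity)]
  exact_mod_cast Iff.rfl

/-- The coverage of the Simes prediction set at the level of scores. -/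
theorem one_sub_le_measureReal_of_simesAdapt {Ω : Type*} [MeasurableSpace Ω] {μ : Measure Ω}
    [IsProbabilityMeasure μ] {m : ℕ} (hm : 1 ≤ m) {c : A ⊕ Fin m → κ} (ν : κ → Measure ℝ)
    [∀ k, IsProbabilityMeasure (ν k)] {Z : A ⊕ Fin m → Ω → ℝ} (hZ : ∀ v, Measurable (Z v))
    (hind : iIndepFun Z μ) (hlaw : ∀ v, μ.map (Z v) = ν (c v)) (r : κ → ℕ) {C α : ℝ} (hC : 0 < C)
    (hα : 0 ≤ α)
    (hsum : ∑ i : Fin m, ∫⁻ z, ENNReal.ofReal (1 + (residual c r i z : ℝ))⁻¹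
      ∂Measure.pi (fun u => ν (c u)) ≤ ENNReal.ofReal C) {E : Set Ω}
    (hE : ∀ᵐ ω ∂μ, α < simesAdapt (C * (1 + aboveCount c r (fun v => Z v ω)))
      (trueP c fun v => Z v ω) → ω ∈ E) :
    1 - α ≤ μ.real E := by
  have hmap : μ.map (fun ω v => Z v ω) = Measure.pi fun u => ν (c u) := by
    rw [(iIndepFun_iff_map_fun_eq_pi_map fun v => (hZ v).aemeasurable).1 hind]
    congr 1
    funext v
    exact hlaw v
  have hbad := measure_stepUp_pos_le (c := c) ν r hC hα hsum
  rw [← hmap] at hbad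
  have hcompl : μ Eᶜ ≤ ENNReal.ofReal α := by
    refine le_trans (le_trans (measure_mono_ae ?_)
      (Measure.le_map_apply (measurable_pi_lambda _ hZ).aemeasurable _)) hbad
    filter_upwards [hE] with ω hω hωE
    refine stepUp_pos_of_simesAdapt_le hm (by positivity) (not_lt.1 fun h => hωE (hω h))
  have h1 : μ.real Eᶜ ≤ α := ENNReal.toReal_le_of_le_ofReal hα hcompl
  -- `E` need not be measurable, so subadditivity replaces the complement rule.
  have h2 := measureReal_union_le (μ := μ) E Eᶜ
  rw [Set.union_compl_self, probReal_univ] at h2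
  linarith

lemma sum_lintegral_inv_residual_le {c : A ⊕ B → κ} (ν : κ → Measure ℝ)
    [∀ k, IsProbabilityMeasure (ν k)] (r : κ → ℕ) (hr : ∀ k, r k ≤ (cal c k).card) {lam : ℝ}
    (hlam : lam < 1) (hle : ∀ k, (r k : ℝ) / ((cal c k).card + 1) ≤ lam) :
    ∑ i : B, ∫⁻ z, ENNReal.ofReal (1 + (residual c r i z : ℝ))⁻¹
      ∂Measure.pi (fun u => ν (c u)) ≤ ENNReal.ofReal (1 - lam)⁻¹ := by
  rw [ENNReal.ofReal_inv_of_pos (by linarith), ENNReal.le_inv_iff_mul_le, Finset.sum_mul]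
  refine le_trans (Finset.sum_le_sum fun i _ => ?_) (sum_mul_lintegral_inv_residual_le ν r hr)
  rw [mul_comm]
  gcongr
  exact hle _

lemma mean_prod_le_kappa {K m : ℕ} {lam : ℝ} (hlam : lam ∈ Set.Ioo (0 : ℝ) 1) (hm : 2 ≤ m)
    (N : Fin K → ℕ) (y : Fin m → Fin K) :
    ∑ i : Fin m, ((m : ℝ)⁻¹ * ∏ j ∈ Finset.univ.erase i,
      (1 / (1 - roundLevel lam (N (y j)))) ^ (1 / ((m : ℝ) - 1))) ≤ kappa lam N y := by
  have hlt : ∀ k, 0 < 1 - roundLevel lam (N k) := fun k => by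
    linarith [(floor_threshold hlam (N k)).2.2, hlam.2]
  have hm1 : (0 : ℝ) < (m : ℝ) - 1 := by
    have : (2 : ℝ) ≤ m := by exact_mod_cast hm
    linarith
  have hprod : ∏ k : Fin K,
      (1 / (1 - roundLevel lam (N k))) ^ ((batchCount y k : ℝ) / ((m : ℝ) - 1)) =
      ∏ j : Fin m, (1 / (1 - roundLevel lam (N (y j)))) ^ (1 / ((m : ℝ) - 1)) := by
    rw [← Finset.prod_fiberwise Finset.univ y]
    refine Finset.prod_congr rfl fun k _ => ?_
    rw [Finset.prod_congr rfl fun j hj => by rw [(Finset.mem_filter.1 hj).2], Finset.prod_const,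
      ← Real.rpow_natCast, ← Real.rpow_mul (one_div_pos.2 (hlt k)).le, batchCount]
    congr 1
    ring
  have hterm : ∀ i, ∏ j ∈ Finset.univ.erase i,
      (1 / (1 - roundLevel lam (N (y j)))) ^ (1 / ((m : ℝ) - 1)) ≤ kappa lam N y := by
    intro i
    -- Omitting the index `i` from the full product costs the factor `(1 - λ_i) ^ (1 / (m - 1))`,
    -- and the first factor of `κ` is the largest such cost over the classes.
    rw [kappa, hprod, ← Finset.mul_prod_erase _ _ (Finset.mem_univ i), ← mul_assoc]
    refine le_mul_of_one_le_left (Finset.prod_nonneg fun j _ =>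
      Real.rpow_nonneg (one_div_pos.2 (hlt _)).le _) ?_
    have hmin : 1 - roundLevel lam (N (y i)) ≤ 1 - ⨅ k : Fin K, roundLevel lam (N k) := by
      have := ciInf_le (Set.finite_range fun k => roundLevel lam (N k)).bddBelow (y i)
      linarith
    rw [← Real.mul_rpow ((hlt _).le.trans hmin) (one_div_pos.2 (hlt _)).le]
    refine Real.one_le_rpow ?_ (by positivity)
    rw [mul_one_div, one_le_div (hlt _)]
    exact hmin
  calc _ ≤ ∑ _i : Fin m, (m : ℝ)⁻¹ * kappa lam N y := by
        gcongr with i _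
        exact hterm i
    _ = kappa lam N y := by
        have : (m : ℝ) ≠ 0 := by positivity
        rw [Finset.sum_const, Finset.card_univ, Fintype.card_fin, nsmul_eq_mul]
        field_simp

end Scores

/-! ### Translation of the two kinds of `p`-values. -/

section Models

variable {𝒳 : Type*} {K n m : ℕ}

/-- Full calibration is class calibration with the one class `()`; the labels survive only inside
the scores. -/
lemma fullPValue_eq_trueP (S : Fin K → 𝒳 → ℝ) (x : Fin n ⊕ Fin m → 𝒳)
    (y : Fin n ⊕ Fin m → Fin K) (i : Fin m) :
    fullPValue S x (fun j => y (Sum.inl j)) (y (Sum.inr i)) i =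
      trueP (fun _ => ()) (fun v => S (y v) (x v)) i := by
  rw [fullPValue, pValue, trueP, exceed_cal, card_cal]
  simp

lemma classPValue_eq_trueP (S : Fin K → 𝒳 → ℝ) (x : Fin n ⊕ Fin m → 𝒳)
    (y : Fin n ⊕ Fin m → Fin K) (i : Fin m) :
    classPValue S x (fun j => y (Sum.inl j)) (y (Sum.inr i)) i =
      trueP y (fun v => S (y v) (x v)) i := by
  rw [classPValue, pValue, trueP, exceed_cal, card_cal]
  rfl

lemma classCount_eq_card_cal (y : Fin n ⊕ Fin m → Fin K) (k : Fin K) :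
    classCount (fun j => y (Sum.inl j)) k = (cal y k).card := (card_cal y k).symm

lemma card_cal_unit (k : Unit) :
    (cal (A := Fin n) (B := Fin m) (fun _ => ()) k).card = n := by
  rw [card_cal]; simp

end Models

end BatchConformal

end

/-! ### The coverage theorem in both models. -/

theorem theorem3 {𝒳 Ω : Type*} [MeasurableSpace 𝒳] [MeasurableSpace Ω]
    (P : Measure Ω) [IsProbabilityMeasure P] {K n m : ℕ} (hm : 1 ≤ m)
    (X : Fin n ⊕ Fin m → Ω → 𝒳) (Y : Fin n ⊕ Fin m → Ω → Fin K)
    (hX : ∀ j, Measurable (X j)) (hY : ∀ j, Measurable (Y j))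
    (S : Fin K → 𝒳 → ℝ) (hS : ∀ k, Measurable (S k))
    (hties : ∀ᵐ ω ∂P, Function.Injective fun j => S (Y j ω) (X j ω))
    (α lam : ℝ) (hα : α ∈ Set.Ioo (0 : ℝ) 1) (hlam : lam ∈ Set.Ioo (0 : ℝ) 1) :
    -- iid model, full-calibrated p-values
    (BatchConformal.IIDModel P X Y →
      ((∃ z : ℤ, ((n : ℝ) + 1) * lam = z) →
        1 - α ≤ P.real (BatchConformal.coverEvent (fun x c =>
          BatchConformal.predSet (BatchConformal.fullPValue S x c)
            (BatchConformal.storey lam (BatchConformal.fullPValue S x c)) α) X Y)) ∧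
      1 - α ≤ P.real (BatchConformal.coverEvent (fun x c =>
        BatchConformal.predSet (BatchConformal.fullPValue S x c)
          (BatchConformal.storeyFull lam n (BatchConformal.fullPValue S x c)) α) X Y)) ∧
    -- conditional model, class-calibrated p-values
    (∀ Q : Fin K → Measure 𝒳, BatchConformal.ConditionalModel P X Y Q →
      ∀ y : Fin n ⊕ Fin m → Fin K, P (BatchConformal.labelEvent Y y) ≠ 0 →
        ((∀ k, ∃ z : ℤ,
            ((BatchConformal.classCount (fun j => y (Sum.inl j)) k : ℝ) + 1) * lam = z) →
          1 - α ≤ (cond P (BatchConformal.labelEvent Y y)).real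
            (BatchConformal.coverEvent (fun x c =>
              BatchConformal.predSet (BatchConformal.classPValue S x c)
                (BatchConformal.storey lam (BatchConformal.classPValue S x c)) α) X Y)) ∧
        (2 ≤ m →
          1 - α ≤ (cond P (BatchConformal.labelEvent Y y)).real
            (BatchConformal.coverEvent (fun x c =>
              BatchConformal.predSet (BatchConformal.classPValue S x c)
                (BatchConformal.storeyClass lam (BatchConformal.classCount c)
                  (BatchConformal.classPValue S x c)) α) X Y))) := by
  have hC : 0 < (1 - lam)⁻¹ := inv_pos.2 (by linarith [hlam.2])
  refine ⟨fun hiid => ?_, fun Q hQ y hy => ?_⟩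
  · have hg : Measurable fun q : 𝒳 × Fin K => S q.2 q.1 :=
      measurable_from_prod_countable_left fun k => hS k
    let Z : Fin n ⊕ Fin m → Ω → ℝ := fun v ω => S (Y v ω) (X v ω)
    have hZ : ∀ v, Measurable (Z v) := fun v => hg.comp ((hX v).prodMk (hY v))
    have hind : iIndepFun Z P := hiid.indep.comp (fun _ q => S q.2 q.1) fun _ => hg
    let v₀ : Fin n ⊕ Fin m := Sum.inr ⟨0, hm⟩
    have hν := Measure.isProbabilityMeasure_map (μ := P) (hZ v₀).aemeasurable
    have hlaw : ∀ v, P.map (Z v) = P.map (Z v₀) := fun v =>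
      ((hiid.ident v v₀).comp hg).map_eq
    -- Both claims of the iid model use a threshold `r / (n + 1) ≤ lam` while keeping the factor `(1
    -- - lam)⁻¹`.
    have key : ∀ r : ℕ, r ≤ n → ∀ t : ℝ, t = (r : ℝ) / ((n : ℝ) + 1) → t ≤ lam →
        1 - α ≤ P.real (BatchConformal.coverEvent (fun x c =>
          BatchConformal.predSet (BatchConformal.fullPValue S x c) (fun y => (1 - lam)⁻¹ *
            (1 + ∑ i : Fin m, if t ≤ BatchConformal.fullPValue S x c (y i) i then (1 : ℝ)
              else 0)) α) X Y) := by
      intro r hr t ht htl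
      refine BatchConformal.one_sub_le_measureReal_of_simesAdapt (c := fun _ => ()) hm
        (fun _ => P.map (Z v₀)) hZ hind hlaw (fun _ => r) hC hα.1.le
        (BatchConformal.sum_lintegral_inv_residual_le (fun _ => P.map (Z v₀)) _
          (fun k => by rwa [BatchConformal.card_cal_unit]) hlam.2
          (fun k => by rwa [BatchConformal.card_cal_unit, ← ht])) ?_
      refine Filter.Eventually.of_forall fun ω h => ?_
      have hp := BatchConformal.fullPValue_eq_trueP S (fun v => X v ω) fun v => Y v ω
      simp only [BatchConformal.coverEvent, BatchConformal.predSet, Set.mem_ofPred_eq, hp]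
      rwa [BatchConformal.sum_threshold_le (fun _ => ()) _ (fun _ => r) (fun _ => t)
        fun k => by rw [BatchConformal.card_cal_unit, ht]]
    refine ⟨fun hz => ?_, ?_⟩
    · obtain ⟨r, hr, hlr⟩ := BatchConformal.exists_nat_threshold hlam hz
      exact key r hr lam hlr le_rfl
    · obtain ⟨h1, h2, h3⟩ := BatchConformal.floor_threshold hlam n
      exact key _ h1 _ h2 h3
  · classical
    set μ := cond P (BatchConformal.labelEvent Y y) with hμ
    have : IsProbabilityMeasure μ := cond_isProbabilityMeasure hy
    have hmeas : MeasurableSet (BatchConformal.labelEvent Y y) := by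
      have : BatchConformal.labelEvent Y y = ⋂ j, Y j ⁻¹' {y j} := by
        ext ω; simp [BatchConformal.labelEvent]
      rw [this]
      exact MeasurableSet.iInter fun j => hY j (measurableSet_singleton _)
    have hae : ∀ᵐ ω ∂μ, ∀ j, Y j ω = y j := ae_cond_mem hmeas
    let Z : Fin n ⊕ Fin m → Ω → ℝ := fun v ω => S (y v) (X v ω)
    have hZ : ∀ v, Measurable (Z v) := fun v => (hS _).comp (hX v)
    have hind : iIndepFun Z μ := (hQ.indep y hy).comp (fun v => S (y v)) fun v => hS _
    -- `Q k` is unconstrained for a class absent from `y`; a Dirac mass then serves as a dummy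
    -- probability law.
    let ν : Fin K → Measure ℝ := fun k =>
      if IsProbabilityMeasure ((Q k).map (S k)) then (Q k).map (S k) else Measure.dirac 0
    have : ∀ k, IsProbabilityMeasure (ν k) := fun k => by
      simp only [ν]
      split_ifs with h
      · exact h
      · infer_instance
    have hlaw : ∀ v, μ.map (Z v) = ν (y v) := fun v => by
      have h1 : μ.map (Z v) = (Q (y v)).map (S (y v)) := by
        rw [← hQ.law y hy v, Measure.map_map (hS _) (hX v)]
        rfl
      have h2 : IsProbabilityMeasure ((Q (y v)).map (S (y v))) :=
        h1 ▸ Measure.isProbabilityMeasure_map (hZ v).aemeasurable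
      simp only [ν, if_pos h2, h1]
    have hp := fun ω => BatchConformal.classPValue_eq_trueP S (fun v => X v ω) y
    have hN : BatchConformal.classCount (fun j => y (Sum.inl j)) =
        fun k => (BatchConformal.cal y k).card :=
      funext fun k => BatchConformal.classCount_eq_card_cal y k
    refine ⟨fun hz => ?_, fun hm2 => ?_⟩
    · choose r hr hlr using fun k => BatchConformal.exists_nat_threshold hlam (hz k)
      simp only [hN] at hr hlr
      refine BatchConformal.one_sub_le_measureReal_of_simesAdapt (c := y) hm ν hZ hind hlaw r hC
        hα.1.le (BatchConformal.sum_lintegral_inv_residual_le ν r hr hlam.2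
          fun k => (hlr k).ge) ?_
      filter_upwards [hae] with ω hω h
      simp only [BatchConformal.coverEvent, BatchConformal.predSet, BatchConformal.storey,
        Set.mem_ofPred_eq, hω, hp]
      rwa [BatchConformal.sum_threshold_le y _ r (fun _ => lam) hlr]
    · let N : Fin K → ℕ := fun k => (BatchConformal.cal y k).card
      let r : Fin K → ℕ := fun k => ⌊lam * ((N k : ℝ) + 1)⌋₊
      have hfl := fun k => BatchConformal.floor_threshold hlam (N k)
      have hsum := BatchConformal.mean_prod_le_kappa hlam hm2 N fun i => y (Sum.inr i)
      have hlt : ∀ k, 0 < 1 - BatchConformal.roundLevel lam (N k) := fun k => by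
        linarith [(hfl k).2.2, hlam.2]
      have hpos : ∀ i : Fin m, 0 < (m : ℝ)⁻¹ * ∏ j ∈ Finset.univ.erase i,
          (1 / (1 - BatchConformal.roundLevel lam (N (y (Sum.inr j))))) ^
            (1 / ((m : ℝ) - 1)) := fun i =>
        mul_pos (by positivity) (Finset.prod_pos fun j _ =>
          Real.rpow_pos_of_pos (one_div_pos.2 (hlt _)) _)
      refine BatchConformal.one_sub_le_measureReal_of_simesAdapt (c := y) hm ν hZ hind hlaw r
        (C := BatchConformal.kappa lam N fun i => y (Sum.inr i))
        (lt_of_lt_of_le (Finset.sum_pos (fun i _ => hpos i) ⟨⟨0, hm⟩, Finset.mem_univ _⟩) hsum)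
        hα.1.le ?_ ?_
      · refine le_trans ?_ (ENNReal.ofReal_le_ofReal hsum)
        rw [ENNReal.ofReal_sum_of_nonneg fun i _ => (hpos i).le]
        refine Finset.sum_le_sum fun i _ => ?_
        have := BatchConformal.lintegral_inv_residual_le (c := y) ν r (fun k => (hfl k).1) i
          (by rwa [Fintype.card_fin])
        simp only [(hfl _).2.1]
        rwa [Fintype.card_fin] at this
      · filter_upwards [hae] with ω hω h
        simp only [BatchConformal.coverEvent, BatchConformal.predSet, BatchConformal.storeyClass,
          Set.mem_ofPred_eq, hω, hp, hN]
        rwa [BatchConformal.sum_threshold_le y _ r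
          (fun k => BatchConformal.roundLevel lam (N k)) fun k => (hfl k).2.1]
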